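/- Let $G(x)=-\tfrac12 e^{-|x|}$, so that $G_x(x)=\tfrac12\,\mathrm{sign}(x)\,e^{-|x|}$ for $x\neq 0$, and consider the Burgers--Poisson equation $$u_t+\Big(\frac{u^2}{2}\Big)_x=[G*u]_x,\qquad u(0,x)=\bar u(x).$$ A function $u\in L^1_{loc}([0,\infty)\times\mathbb R)\cap L^\infty_{loc}\big((0,\infty),L^\infty(\mathbb R)\big)$ is a weak entropy solution if (i) $t\mapsto u(t,\cdot)$ is continuous from $[0,\infty)$ to $L^1(\mathbb R)$ and $u(0,\cdot)=\bar u$; (ii) for every $k\in\mathbb R$ and every non-negative $\phi\in C^1_c((0,\infty)\times\mathbb R)$, $$\iint\Big[|u-k|\,\phi_t+\mathrm{sign}(u-k)\Big(\frac{u^2}{2}-\frac{k^2}{2}\Big)\phi_x+\mathrm{sign}(u-k)\,[G_x*u(t,\cdot)](x)\,\phi\Big]\,dx\,dt\ \ge 0 .$$ **Theorem.** Let $\bar u\in C^1(\mathbb R)\cap L^1(\mathbb R)$, let $m=\|\bar u'\|_{L^\infty(\mathbb R)}\in[0,\infty]$, and let $u$ be the weak entropy solution with initial data $\bar u$. Then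 $\|u_x(t,\cdot)\|_{L^\infty(\mathbb R)}$ remains bounded on $[0,\ln(1+\frac1m))$: for every real $T<\ln(1+\frac1m)$ there is a constant $C<\infty$ such that for all $t\in[0,T]$ the function $u(t,\cdot)$ has a weak derivative $u_x(t,\cdot)\in L^\infty(\mathbb R)$ with $\|u_x(t,\cdot)\|_{L^\infty(\mathbb R)}\le C$. (Here $\ln(1+\frac1m)=+\infty$ if $m=0$, and $\ln(1+\frac1m)=0$ if $m=\infty$.) -/

import Mathlib

open MeasureTheory Set Filter Topology
open scoped ENNReal NNReal ContDiff

namespace BurgersPoisson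

noncomputable section

/-- The Poisson kernel `G(x) = -e^{-|x|}/2`, for which `φ = G * u` solves `φ_xx - φ = u`. -/
def G (x : ℝ) : ℝ := -(1 / 2) * Real.exp (-|x|)

/-- The derivative `G_x` of the Poisson kernel (a jump at the origin; the value there is
immaterial), see `hasDerivAt_G`. -/
def Gx (x : ℝ) : ℝ := (1 / 2) * Real.sign x * Real.exp (-|x|)

theorem hasDerivAt_G {x : ℝ} (hx : x ≠ 0) : HasDerivAt G (Gx x) x := by
  rcases lt_or_gt_of_ne hx with h | h
  · have h1 := ((hasDerivAt_abs_neg h).neg.exp).const_mul (-(1 / 2) : ℝ)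
    refine h1.congr_deriv ?_
    simp only [Gx, Real.sign_of_neg h, Pi.neg_apply]
    ring
  · have h1 := ((hasDerivAt_abs_pos h).neg.exp).const_mul (-(1 / 2) : ℝ)
    refine h1.congr_deriv ?_
    simp only [Gx, Real.sign_of_pos h, Pi.neg_apply]
    ring

/-- The convolution `[G_x * w](x) = ∫ G_x(x - z) w(z) dz`. -/
def convGx (w : ℝ → ℝ) (x : ℝ) : ℝ := ∫ z, Gx (x - z) * w z

/-- `u(t, x)`, `t ≥ 0`, is a weak entropy solution of the Burgers-Poisson equation
`u_t + (u² / 2)_x = [G * u]_x` with initial value `u(0, ·) = ubar`.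
The values `u t x` with `t < 0` play no role. -/
structure IsWeakEntropySolution (ubar : ℝ → ℝ) (u : ℝ → ℝ → ℝ) : Prop where
  /-- `u ∈ L¹_loc([0,∞[ × ℝ)`. -/
  locallyIntegrable :
    LocallyIntegrableOn (fun p : ℝ × ℝ => u p.1 p.2) (Ici 0 ×ˢ univ)
  /-- `u ∈ L^∞_loc(]0,∞[, L^∞(ℝ))`. -/
  locallyBounded : ∀ a b : ℝ, 0 < a → ∃ M : ℝ,
    ∀ᵐ p : ℝ × ℝ ∂(volume.restrict (Icc a b ×ˢ univ)), |u p.1 p.2| ≤ M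
  /-- `u(t, ·) ∈ L¹(ℝ)` for every `t ≥ 0`. -/
  integrable : ∀ t : ℝ, 0 ≤ t → Integrable (u t)
  /-- `t ↦ u(t, ·)` is continuous from `[0,∞[` to `L¹(ℝ)`. -/
  continuous_L1 : ∀ s : ℝ, 0 ≤ s →
    Tendsto (fun t => ∫ x, |u t x - u s x|) (𝓝[Ici 0] s) (𝓝 0)
  /-- The initial condition, as an identity in `L¹(ℝ)`. -/
  initial : u 0 =ᵐ[volume] ubar
  /-- The entropy inequalities. For a test function `φ(t, x)`, the partial derivatives
  `φ_t`, `φ_x` are the Fréchet derivative applied to `(1, 0)` and `(0, 1)`. -/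
  entropy : ∀ (k : ℝ) (φ : ℝ × ℝ → ℝ), ContDiff ℝ 1 φ → HasCompactSupport φ →
    tsupport φ ⊆ Ioi 0 ×ˢ univ → (∀ p, 0 ≤ φ p) →
    0 ≤ ∫ p : ℝ × ℝ in Ioi 0 ×ˢ univ,
      (|u p.1 p.2 - k| * fderiv ℝ φ p (1, 0)
        + Real.sign (u p.1 p.2 - k) * (u p.1 p.2 ^ 2 / 2 - k ^ 2 / 2) * fderiv ℝ φ p (0, 1)
        + Real.sign (u p.1 p.2 - k) * convGx (u p.1) p.2 * φ p)

/-- `g` is the weak (distributional) derivative of `f` on the real line. -/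
structure HasWeakDeriv (f g : ℝ → ℝ) : Prop where
  locallyIntegrable : LocallyIntegrable f
  locallyIntegrable_deriv : LocallyIntegrable g
  integral_eq : ∀ φ : ℝ → ℝ, ContDiff ℝ ∞ φ → HasCompactSupport φ →
    ∫ x, f x * deriv φ x = -∫ x, g x * φ x

end

end BurgersPoisson

namespace BurgersPoisson

/-! Along the characteristics `x' = u` the slope `v = u_x` of a smooth solution obeys `v' = -v² +
G_x * v`. Since `G_x` has unit mass, `y = ‖u_x‖_∞` satisfies `y' ≤ y + y²`. The solution of `y' = y
+ y²`, `y(0) = m`, is `lipBound`, which blows up when `e^s = 1 + 1/m`.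

An entropy solution is not known in advance to be smooth, so the estimate is carried out on an
explicit scheme, `w ↦ w(x - t w(x)) + t (G_x * w)(x)` (`advect`). One step of length `t` turns a
slope bound `L` into `L + t (L + L²)`, an Euler step for the same equation. By convexity the Euler
iterates stay below the exact solution (`lipBound_step`), so all approximations up to time `T` share
the Lipschitz constant `lipBound m T`.

It remains to show that the scheme converges to `u` in `L¹`. Averaging Kruzhkov's inequalities over
constants `k` near a `C¹` function `W` shows that `∫ |u - W|` grows at a rate at most `∫ |G_x * u -
W_t - W W_x|` (`entropy_variable`). For `W` a step of the scheme started from `w`, this rate is at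
most `∫ |u - w|` plus a residual of order `t`. Hence a step of length `δ` has local error `O(δ²)`
(`step_error_le`), and the error at a fixed time is `O(δ)`. An `L¹` limit of functions with a common
Lipschitz constant agrees a.e. with a function having that constant, and its derivative is the
required `u_x`. -/

/-! ### Convolution with the Poisson kernel -/

theorem measurable_sign : Measurable Real.sign := by
  unfold Real.sign
  exact Measurable.ite measurableSet_Iio measurable_const
    (Measurable.ite measurableSet_Ioi measurable_const measurable_const)

theorem abs_sign_le_one (x : ℝ) : |Real.sign x| ≤ 1 := by
  rcases Real.sign_apply_eq x with h | h | h <;> simp [h]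

theorem measurable_Gx : Measurable Gx := by
  unfold Gx
  have := measurable_sign
  fun_prop

theorem abs_Gx_le (x : ℝ) : |Gx x| ≤ 1 / 2 * Real.exp (-|x|) := by
  rw [Gx, abs_mul, abs_mul, abs_of_pos (Real.exp_pos _), abs_of_pos (by norm_num : (0 : ℝ) < 1 / 2)]
  have := abs_sign_le_one x
  gcongr
  linarith

theorem abs_Gx_le_half (x : ℝ) : |Gx x| ≤ 1 / 2 := by
  have h : Real.exp (-|x|) ≤ 1 := Real.exp_le_one_iff.2 (by simp)
  linarith [abs_Gx_le x]

theorem integrable_half_exp_neg_abs : Integrable fun x : ℝ => 1 / 2 * Real.exp (-|x|) := by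
  refine Integrable.const_mul ?_ _
  rw [← integrableOn_univ, ← Iic_union_Ioi (a := (0 : ℝ)), integrableOn_union]
  constructor
  · refine (integrableOn_exp_Iic 0).congr_fun (fun x hx => ?_) measurableSet_Iic
    simp [abs_of_nonpos (mem_Iic.1 hx)]
  · refine (integrableOn_exp_neg_Ioi 0).congr_fun (fun x hx => ?_) measurableSet_Ioi
    simp [abs_of_pos (mem_Ioi.1 hx)]

theorem integral_half_exp_neg_abs : ∫ x : ℝ, 1 / 2 * Real.exp (-|x|) = 1 := by
  rw [integral_const_mul, integral_comp_abs (f := fun x => Real.exp (-x)), integral_exp_neg_Ioi_zero]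
  norm_num

theorem integrable_Gx : Integrable Gx :=
  integrable_half_exp_neg_abs.mono' measurable_Gx.aestronglyMeasurable
    (Eventually.of_forall abs_Gx_le)

/-- The unit mass of the kernel makes convolution a contraction in both the sup norm and `L¹`. The
first gives the linear term of `y' = y + y²`, the second the growth rate of the `L¹` error. -/
theorem integral_abs_Gx_le_one : ∫ x, |Gx x| ≤ 1 := by
  rw [← integral_half_exp_neg_abs]
  exact integral_mono integrable_Gx.abs integrable_half_exp_neg_abs abs_Gx_le

theorem integrable_Gx_sub_mul {w : ℝ → ℝ} (hw : Integrable w) (x : ℝ) :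
    Integrable fun z => Gx (x - z) * w z := by
  refine hw.bdd_mul (c := 1 / 2) ?_ (Eventually.of_forall fun z => abs_Gx_le_half _)
  exact (measurable_Gx.comp (measurable_const.sub measurable_id)).aestronglyMeasurable

theorem convGx_sub {v w : ℝ → ℝ} (hv : Integrable v) (hw : Integrable w) (x : ℝ) :
    convGx (fun y => v y - w y) x = convGx v x - convGx w x := by
  simp only [convGx, mul_sub]
  exact integral_sub (integrable_Gx_sub_mul hv x) (integrable_Gx_sub_mul hw x)

theorem abs_convGx_le_integral {w : ℝ → ℝ} (hw : Integrable w) (x : ℝ) :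
    |convGx w x| ≤ ∫ z, |w z| := by
  refine (abs_integral_le_integral_abs (f := fun z => Gx (x - z) * w z)).trans ?_
  refine integral_mono (integrable_Gx_sub_mul hw x).abs hw.abs fun z => ?_
  simp only [abs_mul]
  nlinarith [abs_Gx_le_half (x - z), abs_nonneg (w z)]

theorem convGx_eq (w : ℝ → ℝ) (x : ℝ) : convGx w x = ∫ z, Gx z * w (x - z) := by
  rw [convGx, ← integral_sub_left_eq_self (fun z => Gx z * w (x - z)) volume x]
  simp

theorem abs_convGx_le_of_bound {w : ℝ → ℝ} {C : ℝ} (hw : ∀ x, |w x| ≤ C)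
    (x : ℝ) : |convGx w x| ≤ C := by
  have hC : 0 ≤ C := (abs_nonneg _).trans (hw 0)
  rw [convGx_eq]
  calc |∫ z, Gx z * w (x - z)| ≤ ∫ z, |Gx z| * C := by
        refine norm_integral_le_of_norm_le (f := fun z => Gx z * w (x - z)) (integrable_Gx.abs.mul_const C)
          (Eventually.of_forall fun z => ?_)
        rw [Real.norm_eq_abs, abs_mul]
        gcongr
        exact hw _
    _ ≤ C := by
        rw [integral_mul_const]
        nlinarith [integral_abs_Gx_le_one]

theorem integrable_prod_Gx_sub_mul {w : ℝ → ℝ} (hw : Integrable w) :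
    Integrable (fun p : ℝ × ℝ => Gx (p.1 - p.2) * w p.2) (volume.prod volume) := by
  have := hw.convolution_integrand (ContinuousLinearMap.mul ℝ ℝ) integrable_Gx (μ := volume)
  simpa [mul_comm] using this

theorem integrable_convGx {w : ℝ → ℝ} (hw : Integrable w) : Integrable (convGx w) :=
  (integrable_prod_Gx_sub_mul hw).integral_prod_left

theorem integral_abs_convGx_le {w : ℝ → ℝ} (hw : Integrable w) :
    ∫ x, |convGx w x| ≤ ∫ x, |w x| := by
  have hi := (integrable_prod_Gx_sub_mul hw).abs
  calc ∫ x, |convGx w x| ≤ ∫ x, ∫ z, |Gx (x - z) * w z| :=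
        integral_mono (integrable_convGx hw).abs hi.integral_prod_left
          fun x => abs_integral_le_integral_abs
    _ = ∫ z, ∫ x, |Gx (x - z) * w z| := integral_integral_swap hi
    _ ≤ ∫ z, |w z| := by
        refine integral_mono hi.integral_prod_right hw.abs fun z => ?_
        simp only [abs_mul]
        rw [integral_mul_const, integral_sub_right_eq_self (fun x => |Gx x|)]
        nlinarith [integral_abs_Gx_le_one, abs_nonneg (w z)]

theorem continuous_convGx_of_bound {w : ℝ → ℝ} {C : ℝ} (hc : Continuous w)
    (hw : ∀ x, |w x| ≤ C) : Continuous (convGx w) := by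
  rw [funext (convGx_eq w)]
  refine continuous_of_dominated (bound := fun z => |Gx z| * C) (fun x => ?_) (fun x => ?_)
    (integrable_Gx.abs.mul_const C) ?_
  · exact (measurable_Gx.mul (hc.measurable.comp
      (measurable_const.sub measurable_id))).aestronglyMeasurable
  · refine Eventually.of_forall fun z => ?_
    rw [Real.norm_eq_abs, abs_mul]
    gcongr
    exact hw _
  · exact Eventually.of_forall fun z => by fun_prop

/-- `Gx` jumps at the origin, so the derivative falls on `w`; the bound on `deriv w` supplies the
dominating function. -/
theorem hasDerivAt_convGx {w : ℝ → ℝ} {L : ℝ} (hc : ContDiff ℝ 1 w) (hw : Integrable w)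
    (hL : ∀ x, |deriv w x| ≤ L) (x : ℝ) : HasDerivAt (convGx w) (convGx (deriv w) x) x := by
  rw [funext (convGx_eq w), convGx_eq]
  have hm (v : ℝ → ℝ) (hv : Continuous v) (y : ℝ) :
      AEStronglyMeasurable (fun z => Gx z * v (y - z)) volume :=
    (measurable_Gx.mul (hv.measurable.comp
      (measurable_const.sub measurable_id))).aestronglyMeasurable
  have hd : Continuous (deriv w) := hc.continuous_deriv le_rfl
  refine (hasDerivAt_integral_of_dominated_loc_of_deriv_le
    (F := fun y z => Gx z * w (y - z)) (F' := fun y z => Gx z * deriv w (y - z))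
    (bound := fun z => |Gx z| * L) univ_mem
    (Eventually.of_forall fun y => hm w hc.continuous y) ?_ (hm _ hd x) ?_
    (integrable_Gx.abs.mul_const L) ?_).2
  · refine (hw.comp_sub_left x).bdd_mul (c := 1 / 2) measurable_Gx.aestronglyMeasurable
      (Eventually.of_forall fun z => abs_Gx_le_half _)
  · refine Eventually.of_forall fun z y _ => ?_
    rw [Real.norm_eq_abs, abs_mul]
    gcongr
    exact hL _
  · refine Eventually.of_forall fun z y _ => ?_
    have h := ((hc.differentiable one_ne_zero (y - z)).hasDerivAt.comp y
      ((hasDerivAt_id y).sub_const z)).const_mul (Gx z)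
    simpa [Function.comp_def] using h

theorem contDiff_convGx {w : ℝ → ℝ} {L : ℝ} (hc : ContDiff ℝ 1 w) (hw : Integrable w)
    (hL : ∀ x, |deriv w x| ≤ L) : ContDiff ℝ 1 (convGx w) := by
  have h := hasDerivAt_convGx hc hw hL
  refine contDiff_one_iff_deriv.2 ⟨fun x => (h x).differentiableAt, ?_⟩
  rw [funext fun x => (h x).deriv]
  exact continuous_convGx_of_bound (hc.continuous_deriv le_rfl) hL

/-! ### One step of the semi-Lagrangian scheme -/

/-- A `C¹` integrable function whose derivative is bounded by `L`. -/
structure IsC1Profile (w : ℝ → ℝ) (L : ℝ) : Prop where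
  contDiff : ContDiff ℝ 1 w
  integrable : Integrable w
  abs_deriv_le : ∀ x, |deriv w x| ≤ L

/-- One semi-Lagrangian step of length `t` for the Burgers-Poisson equation. -/
noncomputable def advect (w : ℝ → ℝ) (t x : ℝ) : ℝ := w (x - t * w x) + t * convGx w x

/-- A bound for the speed at which `t ↦ advect w t x` varies. -/
noncomputable def stepSpeed (w : ℝ → ℝ) (L x : ℝ) : ℝ := L * |w x| + |convGx w x|

/-- A bound, up to a factor `t`, for the residual of `advect w` in the Burgers-Poisson equation. -/
noncomputable def stepDefect (w : ℝ → ℝ) (L x : ℝ) : ℝ :=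
  L * stepSpeed w L x + (|w x| + stepSpeed w L x) * (L + L ^ 2)

@[simp]
theorem advect_zero (w : ℝ → ℝ) : advect w 0 = w := by
  ext x
  simp [advect]

namespace IsC1Profile

variable {w : ℝ → ℝ} {L : ℝ}

theorem nonneg (h : IsC1Profile w L) : 0 ≤ L := (abs_nonneg _).trans (h.abs_deriv_le 0)

theorem hasDerivAt (h : IsC1Profile w L) (x : ℝ) : HasDerivAt w (deriv w x) x :=
  (h.contDiff.differentiable one_ne_zero x).hasDerivAt

theorem abs_sub_le (h : IsC1Profile w L) (x y : ℝ) : |w x - w y| ≤ L * |x - y| :=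
  convex_univ.norm_image_sub_le_of_norm_deriv_le
    (fun z _ => h.contDiff.differentiable one_ne_zero z)
    (fun z _ => h.abs_deriv_le z) (mem_univ y) (mem_univ x)

/-- On the unit interval to the right of `x`, `|w|` falls below `|w x|` by at most `L`; averaging
over that interval brings in the `L¹` norm. -/
theorem abs_le (h : IsC1Profile w L) (x : ℝ) : |w x| ≤ L + ∫ y, |w y| := by
  have h1 : ∫ y in Icc x (x + 1), |w x| ≤ ∫ y in Icc x (x + 1), (L + |w y|) := by
    refine setIntegral_mono_on (by simp) ((integrableOn_const (by simp)).add
      h.integrable.abs.integrableOn) measurableSet_Icc fun y hy => ?_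
    have h2 := h.abs_sub_le x y
    have h3 : |x - y| ≤ 1 := by
      rw [_root_.abs_le]
      constructor <;> linarith [hy.1, hy.2]
    have h4 := abs_sub_abs_le_abs_sub (w x) (w y)
    nlinarith [h.nonneg]
  rw [integral_add (by simp) h.integrable.abs.integrableOn] at h1
  simp at h1
  have h5 : ∫ y in Icc x (x + 1), |w y| ≤ ∫ y, |w y| :=
    setIntegral_le_integral h.integrable.abs (Eventually.of_forall fun y => abs_nonneg _)
  linarith

theorem stepSpeed_nonneg (h : IsC1Profile w L) (x : ℝ) : 0 ≤ stepSpeed w L x := by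
  have := h.nonneg
  unfold stepSpeed
  positivity

theorem integrable_stepSpeed (h : IsC1Profile w L) : Integrable (stepSpeed w L) :=
  (h.integrable.abs.const_mul L).add (integrable_convGx h.integrable).abs

theorem integral_stepSpeed_le (h : IsC1Profile w L) :
    ∫ x, stepSpeed w L x ≤ (L + 1) * ∫ x, |w x| := by
  unfold stepSpeed
  rw [integral_add (h.integrable.abs.const_mul L) (integrable_convGx h.integrable).abs,
    integral_const_mul]
  linarith [integral_abs_convGx_le h.integrable]

theorem integrable_stepDefect (h : IsC1Profile w L) : Integrable (stepDefect w L) :=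
  (h.integrable_stepSpeed.const_mul L).add
    ((h.integrable.abs.add h.integrable_stepSpeed).mul_const (L + L ^ 2))

theorem integral_stepDefect_le (h : IsC1Profile w L) :
    ∫ x, stepDefect w L x ≤ (L * (L + 1) + (L + 2) * (L + L ^ 2)) * ∫ x, |w x| := by
  have hi : Integrable fun x => (|w x| + stepSpeed w L x) * (L + L ^ 2) :=
    (h.integrable.abs.add h.integrable_stepSpeed).mul_const _
  unfold stepDefect
  rw [integral_add (h.integrable_stepSpeed.const_mul L) hi,
    integral_const_mul, integral_mul_const, integral_add h.integrable.abs h.integrable_stepSpeed]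
  have h0 := h.nonneg
  have h1 := h.integral_stepSpeed_le
  have h2 := mul_le_mul_of_nonneg_left h1 h0
  have h3 := mul_le_mul_of_nonneg_left h1 (by positivity : 0 ≤ L + L ^ 2)
  linarith

theorem abs_advect_sub_le (h : IsC1Profile w L) (s t x : ℝ) :
    |advect w t x - advect w s x| ≤ |t - s| * stepSpeed w L x := by
  have h1 := h.abs_sub_le (x - t * w x) (x - s * w x)
  have h2 : |x - t * w x - (x - s * w x)| = |t - s| * |w x| := by
    rw [← abs_mul, abs_sub_comm]
    congr 1
    ring
  rw [h2] at h1
  have h3 : advect w t x - advect w s x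
      = (w (x - t * w x) - w (x - s * w x)) + (t - s) * convGx w x := by
    unfold advect
    ring
  rw [h3]
  refine (abs_add_le _ _).trans ?_
  rw [abs_mul]
  unfold stepSpeed
  linarith

theorem hasDerivAt_advect_time (h : IsC1Profile w L) (t x : ℝ) :
    HasDerivAt (fun s => advect w s x)
      (deriv w (x - t * w x) * (-w x) + convGx w x) t := by
  have h1 : HasDerivAt (fun s => x - s * w x) (-w x) t := by
    simpa using ((hasDerivAt_id t).mul_const (w x)).const_sub x
  have h2 := ((h.hasDerivAt (x - t * w x)).comp t h1).add
    ((hasDerivAt_id t).mul_const (convGx w x))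
  refine h2.congr_deriv ?_
  ring

theorem hasDerivAt_advect (h : IsC1Profile w L) (t x : ℝ) :
    HasDerivAt (advect w t)
      (deriv w (x - t * w x) * (1 - t * deriv w x) + t * convGx (deriv w) x) x := by
  have h1 : HasDerivAt (fun y => y - t * w y) (1 - t * deriv w x) x :=
    (hasDerivAt_id x).sub ((h.hasDerivAt x).const_mul t)
  exact (HasDerivAt.comp x (h.hasDerivAt (x - t * w x)) h1).add
    ((hasDerivAt_convGx h.contDiff h.integrable h.abs_deriv_le x).const_mul t)

theorem contDiff_advect_prod (h : IsC1Profile w L) (a : ℝ) :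
    ContDiff ℝ 1 fun p : ℝ × ℝ => advect w (p.1 - a) p.2 := by
  have h1 := h.contDiff
  have h2 := contDiff_convGx h.contDiff h.integrable h.abs_deriv_le
  unfold advect
  fun_prop

theorem fderiv_advect_time (h : IsC1Profile w L) (a : ℝ) (p : ℝ × ℝ) :
    fderiv ℝ (fun p : ℝ × ℝ => advect w (p.1 - a) p.2) p (1, 0)
      = deriv w (p.2 - (p.1 - a) * w p.2) * (-w p.2) + convGx w p.2 := by
  have h1 := (h.contDiff_advect_prod a).differentiable one_ne_zero p
  have h2 := h1.hasFDerivAt.comp_hasDerivAt p.1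
    ((hasDerivAt_id p.1).prodMk (hasDerivAt_const p.1 p.2))
  refine h2.unique ?_
  have h3 := (h.hasDerivAt_advect_time (p.1 - a) p.2).comp p.1 ((hasDerivAt_id p.1).sub_const a)
  simpa [Function.comp_def] using h3

theorem fderiv_advect_space (h : IsC1Profile w L) (a : ℝ) (p : ℝ × ℝ) :
    fderiv ℝ (fun p : ℝ × ℝ => advect w (p.1 - a) p.2) p (0, 1)
      = deriv w (p.2 - (p.1 - a) * w p.2) * (1 - (p.1 - a) * deriv w p.2)
        + (p.1 - a) * convGx (deriv w) p.2 := by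
  have h1 := (h.contDiff_advect_prod a).differentiable one_ne_zero p
  have h2 := h1.hasFDerivAt.comp_hasDerivAt p.2
    ((hasDerivAt_const p.2 p.1).prodMk (hasDerivAt_id p.2))
  refine h2.unique ?_
  exact h.hasDerivAt_advect (p.1 - a) p.2

theorem abs_advect_le (h : IsC1Profile w L) {t : ℝ} (ht : 0 ≤ t) (x : ℝ) :
    |advect w t x| ≤ |w x| + t * stepSpeed w L x := by
  have h1 := h.abs_advect_sub_le 0 t x
  rw [advect_zero, sub_zero, abs_of_nonneg ht] at h1
  linarith [abs_sub_abs_le_abs_sub (advect w t x) (w x)]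

/-- The foot `x - t w(x)` of the characteristic uses the speed at the arrival point, so the step is
an explicit composition and stays `C¹` with no map to invert. The chain rule contributes `L (1 + t
L)` and the contraction property of the convolution contributes `t L`. -/
theorem advect_isC1Profile (h : IsC1Profile w L) {t : ℝ} (ht : 0 ≤ t) :
    IsC1Profile (advect w t) (L * (1 + t * L) + t * L) where
  contDiff := by
    have h1 := h.contDiff
    have h2 := contDiff_convGx h.contDiff h.integrable h.abs_deriv_le
    unfold advect
    fun_prop
  integrable := by
    refine (h.integrable.abs.add (h.integrable_stepSpeed.const_mul t)).mono' ?_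
      (Eventually.of_forall fun x => h.abs_advect_le ht x)
    have h1 := h.contDiff
    have h2 := contDiff_convGx h.contDiff h.integrable h.abs_deriv_le
    have h3 : ContDiff ℝ 1 (advect w t) := by
      unfold advect
      fun_prop
    exact h3.continuous.aestronglyMeasurable
  abs_deriv_le x := by
    rw [(h.hasDerivAt_advect t x).deriv]
    have h0 := h.nonneg
    have h1 := abs_convGx_le_of_bound h.abs_deriv_le x
    have h2 : |1 - t * deriv w x| ≤ 1 + t * L := by
      refine (abs_sub _ _).trans ?_
      rw [abs_one, abs_mul, abs_of_nonneg ht]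
      gcongr
      exact h.abs_deriv_le x
    refine (abs_add_le _ _).trans ?_
    rw [abs_mul, abs_mul, abs_of_nonneg ht]
    gcongr
    exact h.abs_deriv_le _

theorem integral_abs_advect_le (h : IsC1Profile w L) {t : ℝ} (ht : 0 ≤ t) :
    ∫ x, |advect w t x| ≤ (1 + t * (L + 1)) * ∫ x, |w x| := by
  have hi := h.integrable_stepSpeed.const_mul t
  calc ∫ x, |advect w t x| ≤ ∫ x, (|w x| + t * stepSpeed w L x) :=
        integral_mono (h.advect_isC1Profile ht).integrable.abs (h.integrable.abs.add hi)
          fun x => h.abs_advect_le ht x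
    _ = (∫ x, |w x|) + t * ∫ x, stepSpeed w L x := by
        rw [integral_add h.integrable.abs hi, integral_const_mul]
    _ ≤ _ := by
        have := mul_le_mul_of_nonneg_left h.integral_stepSpeed_le ht
        linarith

/-- The scheme is consistent to first order: transport by the frozen speed `w` differs from
transport by `advect w t` only through a difference of order `t`. The restriction to one unit of
time lets the bound on `advect w t` itself be free of `t`. -/
theorem abs_residual_le (h : IsC1Profile w L) {a : ℝ} {p : ℝ × ℝ} (h0 : a ≤ p.1)
    (h1 : p.1 ≤ a + 1) :
    |convGx w p.2 - fderiv ℝ (fun p : ℝ × ℝ => advect w (p.1 - a) p.2) p (1, 0)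
      - advect w (p.1 - a) p.2 * fderiv ℝ (fun p : ℝ × ℝ => advect w (p.1 - a) p.2) p (0, 1)|
      ≤ (p.1 - a) * stepDefect w L p.2 := by
  rw [h.fderiv_advect_time, h.fderiv_advect_space]
  obtain ⟨t, ht⟩ : ∃ t, t = p.1 - a := ⟨_, rfl⟩
  rw [← ht]
  have ht0 : 0 ≤ t := by linarith
  have ht1 : t ≤ 1 := by linarith
  generalize p.2 = x
  have hL := h.nonneg
  have hd := h.abs_deriv_le (x - t * w x)
  have hs := h.stepSpeed_nonneg x
  have hA := h.abs_advect_le ht0 x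
  have hB := h.abs_advect_sub_le 0 t x
  rw [advect_zero, sub_zero, abs_of_nonneg ht0] at hB
  have hF := abs_convGx_le_of_bound h.abs_deriv_le x
  set D := deriv w (x - t * w x)
  set W := advect w t x
  -- The terms of order one cancel: the sources drop out, and the two transport terms combine into
  -- `D * (W - w x)`, which is controlled by `stepSpeed`.
  have e1 : convGx w x - (D * (-w x) + convGx w x)
      - W * (D * (1 - t * deriv w x) + t * convGx (deriv w) x)
      = -(D * (W - w x)) - t * (W * (convGx (deriv w) x - D * deriv w x)) := by ring
  rw [e1]
  have h2 : |D * (W - w x)| ≤ L * (t * stepSpeed w L x) := by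
    rw [abs_mul]
    gcongr
  have h3 : |convGx (deriv w) x - D * deriv w x| ≤ L + L ^ 2 := by
    refine (abs_sub _ _).trans ?_
    rw [abs_mul, sq]
    gcongr
    exact h.abs_deriv_le x
  have h4 : |W| ≤ |w x| + stepSpeed w L x := by nlinarith
  have h5 : |t * (W * (convGx (deriv w) x - D * deriv w x))|
      ≤ t * ((|w x| + stepSpeed w L x) * (L + L ^ 2)) := by
    rw [abs_mul, abs_mul, abs_of_nonneg ht0]
    gcongr
  refine (abs_sub _ _).trans ?_
  rw [abs_neg]
  unfold stepDefect
  linarith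

end IsC1Profile

/-! ### Kruzhkov entropies averaged over the constant -/

theorem sign_mul_self (x : ℝ) : Real.sign x * x = |x| := by
  rcases lt_trichotomy x 0 with h | h | h
  · rw [Real.sign_of_neg h, abs_of_neg h]; ring
  · simp [h]
  · rw [Real.sign_of_pos h, abs_of_pos h]; ring

theorem sign_mul_sq_sub (U k : ℝ) :
    Real.sign (U - k) * (U ^ 2 / 2 - k ^ 2 / 2) = |U - k| * ((U + k) / 2) := by
  rw [← sign_mul_self (U - k)]
  ring

theorem hasDerivAt_abs_sub {U k : ℝ} (h : k ≠ U) :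
    HasDerivAt (fun k => |U - k|) (-Real.sign (U - k)) k := by
  have h1 : HasDerivAt (fun k => U - k) (-1) k := by simpa using (hasDerivAt_id k).const_sub U
  rcases lt_or_gt_of_ne h with h | h
  · have := (hasDerivAt_abs_pos (sub_pos.2 h)).comp k h1
    rw [Real.sign_of_pos (sub_pos.2 h)]
    simpa [Function.comp_def] using this
  · have := (hasDerivAt_abs_neg (sub_neg.2 h)).comp k h1
    rw [Real.sign_of_neg (sub_neg.2 h)]
    simpa [Function.comp_def] using this

/-- As a function of `k` the entropy flux has derivative `-sign(U - k) k`, so its modulus of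
continuity near `v` does not involve `U`. -/
theorem abs_flux_sub_le (U v k : ℝ) :
    |(|U - k| * ((U + k) / 2) - |U - v| * ((U + v) / 2))| ≤ |k - v| * (|v| + |k - v|) := by
  have hv := abs_le.1 (le_refl |v|)
  have hk := abs_le.1 (le_refl |k - v|)
  rcases le_total k U with h1 | h1 <;> rcases le_total v U with h2 | h2 <;>
  rcases le_total k v with h3 | h3 <;>
  first
  | rw [abs_of_nonneg (sub_nonneg.2 h1)]
  | rw [abs_of_nonpos (sub_nonpos.2 h1)]
  all_goals first
  | rw [abs_of_nonneg (sub_nonneg.2 h2)]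
  | rw [abs_of_nonpos (sub_nonpos.2 h2)]
  all_goals first
  | rw [abs_of_nonneg (sub_nonneg.2 h3)] at hk ⊢
  | rw [abs_of_nonpos (sub_nonpos.2 h3)] at hk ⊢
  all_goals
    rw [abs_le]
    constructor <;> nlinarith

theorem integrableOn_sign_sub_mul {f : ℝ → ℝ} (hf : Continuous f) (U a b : ℝ) :
    IntegrableOn (fun k => Real.sign (U - k) * f k) (Icc a b) := by
  refine Integrable.bdd_mul (c := 1) hf.integrableOn_Icc ?_
    (Eventually.of_forall fun k => abs_sign_le_one _)
  exact (measurable_sign.comp (measurable_const.sub measurable_id)).aestronglyMeasurable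

/-- Integration by parts in the parameter `k` of the Kruzhkov entropies against a kernel `r`
concentrated near `v`. -/
theorem integral_entropy_le {r : ℝ → ℝ} {ε : ℝ} (hε : 0 ≤ ε) (hr : ContDiff ℝ 1 r)
    (hr0 : ∀ s, 0 ≤ r s) (hr1 : ∫ s, r s = 1) (hrs : ∀ s, ε < |s| → r s = 0)
    (U v A B F ψ ψt ψx : ℝ) (hψ : 0 ≤ ψ) :
    ∫ k, (|U - k| * (ψt * r (k - v) - ψ * (deriv r (k - v) * A))
        + Real.sign (U - k) * (U ^ 2 / 2 - k ^ 2 / 2)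
          * (ψx * r (k - v) - ψ * (deriv r (k - v) * B))
        + Real.sign (U - k) * F * (ψ * r (k - v)))
      ≤ |U - v| * ψt + |U - v| * ((U + v) / 2) * ψx + ψ * |F - A - v * B|
        + ε * (|ψt| + (|v| + ε) * |ψx| + ψ * |B|) := by
  have hrc := hr.continuous
  have hrd : Continuous (deriv r) := hr.continuous_deriv le_rfl
  have hds : ∀ s, ε < |s| → deriv r s = 0 := fun s hs => by
    have : r =ᶠ[𝓝 s] fun _ => 0 := by
      filter_upwards [(isOpen_lt continuous_const continuous_abs).mem_nhds hs] with y hy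
      exact hrs y hy
    rw [this.deriv_eq, deriv_const]
  set a := v - ε - 1
  set b := v + ε + 1
  have hab : a ≤ b := by simp only [a, b]; linarith
  have hout : ∀ k, k ∉ Icc a b → ε < |k - v| := fun k hk => by
    by_contra! h
    rw [abs_le] at h
    exact hk ⟨by simp only [a]; linarith, by simp only [b]; linarith⟩
  -- `Φ'` is the derivative in `k` of `|U - k| (A + (U + k)/2 B) r(k - v)`, whose integral is zero.
  -- Adding `ψ Φ'` removes every term with `deriv r`, which would be of order `1/ε`, and turns the
  -- source `F` into the residual `F - A - k B`.
  set Φ' : ℝ → ℝ := fun k => -(Real.sign (U - k) * ((A + k * B) * r (k - v)))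
    + |U - k| * (A + (U + k) / 2 * B) * deriv r (k - v)
  set H : ℝ → ℝ := fun k => |U - k| * (ψt + (U + k) / 2 * ψx) * r (k - v)
    + Real.sign (U - k) * (ψ * (F - A - k * B) * r (k - v))
  have hΦi : IntegrableOn Φ' (Icc a b) :=
    (integrableOn_sign_sub_mul (by fun_prop) U a b).neg.add
      (Continuous.integrableOn_Icc (by fun_prop))
  have hHi : IntegrableOn H (Icc a b) :=
    (Continuous.integrableOn_Icc (by fun_prop)).add
      (integrableOn_sign_sub_mul (by fun_prop) U a b)
  have hΦ0 : ∫ k in Icc a b, Φ' k = 0 := by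
    rw [integral_Icc_eq_integral_Ioc, ← intervalIntegral.integral_of_le hab,
      integral_eq_of_hasDerivAt_off_countable
        (fun k => |U - k| * (A + (U + k) / 2 * B) * r (k - v)) Φ' (countable_singleton U)]
    · rw [hrs (b - v), hrs (a - v)]
      · simp
      · simp only [a]
        rw [abs_of_neg] <;> linarith
      · simp only [b]
        rw [abs_of_pos] <;> linarith
    · exact Continuous.continuousOn (by fun_prop)
    · rintro k ⟨-, hk⟩
      have h1 := hasDerivAt_abs_sub (U := U) (k := k) hk
      have h2 : HasDerivAt (fun k => A + (U + k) / 2 * B) (1 / 2 * B) k :=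
        ((((hasDerivAt_id k).const_add U).div_const 2).mul_const B).const_add A
      have h3 : HasDerivAt (fun k => r (k - v)) (deriv r (k - v)) k := by
        simpa [Function.comp_def] using
          (hr.differentiable one_ne_zero (k - v)).hasDerivAt.comp k ((hasDerivAt_id k).sub_const v)
      refine ((h1.mul h2).mul h3).congr_deriv ?_
      simp only [Φ', Pi.mul_apply]
      rw [← sign_mul_self (U - k)]
      ring
    · rw [intervalIntegrable_iff_integrableOn_Icc_of_le hab]
      exact hΦi
  set c := |U - v| * ψt + |U - v| * ((U + v) / 2) * ψx + ψ * |F - A - v * B|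
        + ε * (|ψt| + (|v| + ε) * |ψx| + ψ * |B|)
  -- On the support of the kernel `|k - v| ≤ ε`, so replacing `k` by `v` in each factor costs
  -- `O(ε)`.
  have hHle : ∀ k, H k ≤ c * r (k - v) := fun k => by
    rcases lt_or_ge ε |k - v| with hk | hk
    · simp [H, hrs _ hk]
    have e1 : H k = (|U - k| * ψt + |U - k| * ((U + k) / 2) * ψx
        + ψ * (Real.sign (U - k) * (F - A - k * B))) * r (k - v) := by
      simp only [H]
      ring
    rw [e1]
    refine mul_le_mul_of_nonneg_right ?_ (hr0 _)
    have h1 : |U - k| * ψt ≤ |U - v| * ψt + ε * |ψt| := by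
      have h := abs_abs_sub_abs_le_abs_sub (U - k) (U - v)
      have h' : |U - k - (U - v)| = |k - v| := by rw [abs_sub_comm]; congr 1; ring
      rw [h'] at h
      have h2 : (|U - k| - |U - v|) * ψt ≤ ε * |ψt| := by
        refine (le_abs_self _).trans ?_
        rw [abs_mul]
        gcongr
        exact h.trans hk
      linarith
    have h2 : |U - k| * ((U + k) / 2) * ψx
        ≤ |U - v| * ((U + v) / 2) * ψx + ε * ((|v| + ε) * |ψx|) := by
      have h := abs_flux_sub_le U v k
      have h' : (|U - k| * ((U + k) / 2) - |U - v| * ((U + v) / 2)) * ψx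
          ≤ ε * (|v| + ε) * |ψx| := by
        refine (le_abs_self _).trans ?_
        rw [abs_mul]
        gcongr
        refine h.trans ?_
        gcongr
      linarith
    have h3 : Real.sign (U - k) * (F - A - k * B) ≤ |F - A - v * B| + ε * |B| := by
      refine (le_abs_self _).trans ?_
      rw [abs_mul]
      have e2 : F - A - k * B = (F - A - v * B) - (k - v) * B := by ring
      have h4 : |F - A - k * B| ≤ |F - A - v * B| + ε * |B| := by
        rw [e2]
        refine (abs_sub _ _).trans ?_
        rw [abs_mul]
        gcongr
      nlinarith [abs_sign_le_one (U - k), abs_nonneg (F - A - k * B)]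
    have h4 := mul_le_mul_of_nonneg_left h3 hψ
    simp only [c]
    linarith
  have hrv : IntegrableOn (fun k => c * r (k - v)) (Icc a b) :=
    Continuous.integrableOn_Icc (by fun_prop)
  rw [← setIntegral_eq_integral_of_forall_compl_eq_zero (s := Icc a b)]
  · calc _ = ∫ k in Icc a b, (H k - ψ * Φ' k) := by
          refine integral_congr_ae (Eventually.of_forall fun k => ?_)
          simp only [H, Φ', sign_mul_sq_sub]
          ring
      _ = ∫ k in Icc a b, H k := by
          rw [integral_sub hHi (hΦi.const_mul ψ), integral_const_mul, hΦ0]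
          simp
      _ ≤ ∫ k in Icc a b, c * r (k - v) := integral_mono hHi hrv hHle
      _ = c := by
          rw [setIntegral_eq_integral_of_forall_compl_eq_zero fun k hk => by
            rw [hrs _ (hout k hk), mul_zero], integral_const_mul,
            integral_sub_right_eq_self (fun s => r s), hr1, mul_one]
  · intro k hk
    rw [hrs _ (hout k hk), hds _ (hout k hk)]
    simp

/-! ### Continuity, measurability and bounds for entropy solutions -/

theorem continuousOn_integral_abs_sub {u w : ℝ → ℝ → ℝ} {s : Set ℝ}
    (hu : ∀ t ∈ s, Integrable (u t)) (hw : ∀ t ∈ s, Integrable (w t))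
    (huc : ∀ a ∈ s, Tendsto (fun t => ∫ x, |u t x - u a x|) (𝓝[s] a) (𝓝 0))
    (hwc : ∀ a ∈ s, Tendsto (fun t => ∫ x, |w t x - w a x|) (𝓝[s] a) (𝓝 0)) :
    ContinuousOn (fun t => ∫ x, |u t x - w t x|) s := by
  intro a ha
  have h0 := (huc a ha).add (hwc a ha)
  rw [add_zero] at h0
  refine tendsto_iff_norm_sub_tendsto_zero.2 (squeeze_zero' (Eventually.of_forall fun t =>
    norm_nonneg _) ?_ h0)
  filter_upwards [self_mem_nhdsWithin] with t ht
  have i1 := ((hu t ht).sub (hw t ht)).abs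
  have i2 := ((hu a ha).sub (hw a ha)).abs
  have i3 := ((hu t ht).sub (hu a ha)).abs
  have i4 := ((hw t ht).sub (hw a ha)).abs
  simp only [Pi.sub_apply] at i1 i2 i3 i4
  rw [← integral_sub i1 i2, ← integral_add i3 i4]
  refine norm_integral_le_of_norm_le (i3.add i4) (Eventually.of_forall fun x => ?_)
  rw [Real.norm_eq_abs]
  refine (abs_abs_sub_abs_le_abs_sub _ _).trans ?_
  have e : u t x - w t x - (u a x - w a x) = (u t x - u a x) - (w t x - w a x) := by ring
  rw [e]
  exact abs_sub _ _

theorem restrict_Ioi_prod_univ :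
    (volume : Measure (ℝ × ℝ)).restrict (Ioi 0 ×ˢ univ)
      = ((volume : Measure ℝ).restrict (Ioi 0)).prod volume := by
  rw [Measure.volume_eq_prod, ← Measure.prod_restrict, Measure.restrict_univ]

namespace IsWeakEntropySolution

variable {ubar : ℝ → ℝ} {u : ℝ → ℝ → ℝ}

theorem aestronglyMeasurable (hu : IsWeakEntropySolution ubar u) :
    AEStronglyMeasurable (fun p : ℝ × ℝ => u p.1 p.2) (volume.restrict (Ioi 0 ×ˢ univ)) :=
  hu.locallyIntegrable.aestronglyMeasurable.mono_measure
    (Measure.restrict_mono (prod_mono_left Ioi_subset_Ici_self) le_rfl)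

theorem aestronglyMeasurable_convGx (hu : IsWeakEntropySolution ubar u) :
    AEStronglyMeasurable (fun p : ℝ × ℝ => convGx (u p.1) p.2)
      (volume.restrict (Ioi 0 ×ˢ univ)) := by
  have h := hu.aestronglyMeasurable
  rw [restrict_Ioi_prod_univ] at h ⊢
  -- `u` is only a.e. measurable in `(t, x)`, so pulling it back along `((t, x), z) ↦ (t, z)`
  -- requires null sets to have null preimages.
  have hq : Measure.QuasiMeasurePreserving (fun q : (ℝ × ℝ) × ℝ => (q.1.1, q.2))
      ((((volume : Measure ℝ).restrict (Ioi 0)).prod volume).prod volume)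
      (((volume : Measure ℝ).restrict (Ioi 0)).prod volume) :=
    QuasiMeasurePreserving.prodMap
      (Measure.quasiMeasurePreserving_fst (μ := (volume : Measure ℝ).restrict (Ioi 0))
        (ν := (volume : Measure ℝ)))
      (Measure.QuasiMeasurePreserving.id (volume : Measure ℝ))
  have h2 := h.comp_quasiMeasurePreserving hq
  have h3 : AEStronglyMeasurable (fun q : (ℝ × ℝ) × ℝ => Gx (q.1.2 - q.2))
      ((((volume : Measure ℝ).restrict (Ioi 0)).prod volume).prod volume) :=
    (measurable_Gx.comp ((measurable_snd.comp measurable_fst).sub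
      measurable_snd)).aestronglyMeasurable
  exact (h3.mul h2).integral_prod_right'

theorem continuousOn_integral_abs (hu : IsWeakEntropySolution ubar u) :
    ContinuousOn (fun t => ∫ x, |u t x|) (Ici 0) := by
  have := continuousOn_integral_abs_sub (s := Ici 0) (w := fun _ _ => 0) hu.integrable (fun _ _ => by simp)
    hu.continuous_L1 (fun _ _ => by simpa using tendsto_const_nhds)
  simpa using this

theorem exists_abs_convGx_le (hu : IsWeakEntropySolution ubar u) {a : ℝ} (ha : 0 ≤ a) (b : ℝ) :
    ∃ C, ∀ t ∈ Icc a b, ∀ x, |convGx (u t) x| ≤ C := by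
  obtain ⟨C, hC⟩ := isCompact_Icc.exists_bound_of_continuousOn
    (hu.continuousOn_integral_abs.mono (fun t (ht : t ∈ Icc a b) => ha.trans ht.1))
  exact ⟨C, fun t ht x => (abs_convGx_le_integral (hu.integrable t (ha.trans ht.1)) x).trans
    ((le_abs_self _).trans (hC t ht))⟩

theorem exists_ae_bound_of_isCompact (hu : IsWeakEntropySolution ubar u) {K : Set (ℝ × ℝ)}
    (hK : IsCompact K) (hK0 : K ⊆ Ioi 0 ×ˢ univ) :
    ∃ M, 0 ≤ M ∧ (∀ᵐ p ∂(volume.restrict K), |u p.1 p.2| ≤ M) ∧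
      ∀ p ∈ K, |convGx (u p.1) p.2| ≤ M := by
  rcases K.eq_empty_or_nonempty with rfl | hne
  · exact ⟨0, le_rfl, by simp, by simp⟩
  obtain ⟨p, hp, hmin⟩ := hK.exists_isMinOn hne continuous_fst.continuousOn
  obtain ⟨q, hq, hmax⟩ := hK.exists_isMaxOn hne continuous_fst.continuousOn
  have hp0 : 0 < p.1 := (hK0 hp).1
  have hsub : K ⊆ Icc p.1 q.1 ×ˢ univ := fun z hz => ⟨⟨hmin hz, hmax hz⟩, mem_univ _⟩
  obtain ⟨M, hM⟩ := hu.locallyBounded p.1 q.1 hp0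
  obtain ⟨C, hC⟩ := hu.exists_abs_convGx_le hp0.le q.1
  refine ⟨max (max M C) 0, le_max_right _ _, ?_, fun z hz => ?_⟩
  · filter_upwards [ae_restrict_of_ae_restrict_of_subset hsub hM] with z hz
    exact hz.trans ((le_max_left _ _).trans (le_max_left _ _))
  · exact (hC z.1 (hsub hz).1 z.2).trans ((le_max_right _ _).trans (le_max_left _ _))

end IsWeakEntropySolution

/-! ### Kruzhkov's inequality against a `C¹` function -/

/-- A smooth probability density supported in `[-ε, ε]`. -/
theorem exists_smooth_density {ε : ℝ} (hε : 0 < ε) : ∃ r : ℝ → ℝ, ContDiff ℝ ∞ r ∧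
    (∀ s, 0 ≤ r s) ∧ ∫ s, r s = 1 ∧ ∀ s, ε < |s| → r s = 0 := by
  let f : ContDiffBump (0 : ℝ) := ⟨ε / 2, ε, by linarith, by linarith⟩
  refine ⟨f.normed volume, f.contDiff_normed, fun s => f.nonneg_normed s, f.integral_normed,
    fun s hs => ?_⟩
  rw [← Function.notMem_support, f.support_normed_eq, Metric.mem_ball, dist_zero_right,
    Real.norm_eq_abs]
  exact not_lt.2 hs.le

theorem fderiv_mul_comp_const_sub {r : ℝ → ℝ} {ψ W : ℝ × ℝ → ℝ} (hr : ContDiff ℝ 1 r)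
    (hψ : ContDiff ℝ 1 ψ) (hW : ContDiff ℝ 1 W) (k : ℝ) (p v : ℝ × ℝ) :
    fderiv ℝ (fun p => ψ p * r (k - W p)) p v
      = fderiv ℝ ψ p v * r (k - W p) - ψ p * (deriv r (k - W p) * fderiv ℝ W p v) := by
  have h1 := (hψ.differentiable one_ne_zero p).hasFDerivAt
  have h2 := ((hr.differentiable one_ne_zero (k - W p)).hasDerivAt.comp_hasFDerivAt p
    ((hW.differentiable one_ne_zero p).hasFDerivAt.const_sub k))
  refine (congrArg (fun T : ℝ × ℝ →L[ℝ] ℝ => T v) (h1.mul h2).fderiv).trans ?_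
  simp
  ring

namespace IsWeakEntropySolution

variable {ubar : ℝ → ℝ} {u : ℝ → ℝ → ℝ}

/-- The Kruzhkov inequality in which the constant `k` is replaced by a `C¹` function `W`, tested
against `ψ` and with an error of size `ε`. -/
theorem entropy_variable_approx (hu : IsWeakEntropySolution ubar u) {W ψ : ℝ × ℝ → ℝ}
    (hW : ContDiff ℝ 1 W) (hψ : ContDiff ℝ 1 ψ) (hψc : HasCompactSupport ψ)
    (hψs : tsupport ψ ⊆ Ioi 0 ×ˢ univ) (hψ0 : ∀ p, 0 ≤ ψ p) {ε : ℝ} (hε : 0 < ε) :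
    0 ≤ (∫ p : ℝ × ℝ in tsupport ψ, (|u p.1 p.2 - W p| * fderiv ℝ ψ p (1, 0)
        + |u p.1 p.2 - W p| * ((u p.1 p.2 + W p) / 2) * fderiv ℝ ψ p (0, 1)
        + ψ p * |convGx (u p.1) p.2 - fderiv ℝ W p (1, 0) - W p * fderiv ℝ W p (0, 1)|))
      + ε * ∫ p : ℝ × ℝ in tsupport ψ, (|fderiv ℝ ψ p (1, 0)|
        + (|W p| + ε) * |fderiv ℝ ψ p (0, 1)| + ψ p * |fderiv ℝ W p (0, 1)|) := by
  obtain ⟨r, hr', hr0, hr1, hrs⟩ := exists_smooth_density hε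
  have hr : ContDiff ℝ 1 r := hr'.of_le (by norm_cast)
  set K := tsupport ψ
  have hK : IsCompact K := hψc
  have hKm : MeasurableSet K := hK.measurableSet
  obtain ⟨M, hM0, hM, hMF⟩ := hu.exists_ae_bound_of_isCompact hK hψs
  have : IsFiniteMeasure ((volume : Measure (ℝ × ℝ)).restrict K) :=
    ⟨by rw [Measure.restrict_apply_univ]; exact hK.measure_lt_top⟩
  obtain ⟨c, hc⟩ := hK.exists_bound_of_continuousOn hW.continuous.continuousOn
  have hrc := hr.continuous
  have hrd : Continuous (deriv r) := hr.continuous_deriv le_rfl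
  have hWc := hW.continuous
  have hψcont := hψ.continuous
  have hWd (v : ℝ × ℝ) : Continuous fun p => fderiv ℝ W p v :=
    (hW.continuous_fderiv one_ne_zero).clm_apply continuous_const
  have hψd (v : ℝ × ℝ) : Continuous fun p => fderiv ℝ ψ p v :=
    (hψ.continuous_fderiv one_ne_zero).clm_apply continuous_const
  have hWt := hWd (1, 0)
  have hWx := hWd (0, 1)
  have hψt := hψd (1, 0)
  have hψx := hψd (0, 1)
  have hψz : ∀ p, p ∉ K → ψ p = 0 := fun p hp => image_eq_zero_of_notMem_tsupport hp
  have hψdz : ∀ p, p ∉ K → fderiv ℝ ψ p = 0 := fun p hp =>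
    image_eq_zero_of_notMem_tsupport fun h => hp (tsupport_fderiv_subset ℝ h)
  have hum : AEStronglyMeasurable (fun p : ℝ × ℝ => u p.1 p.2) (volume.restrict K) :=
    hu.aestronglyMeasurable.mono_measure (Measure.restrict_mono hψs le_rfl)
  have hFm : AEStronglyMeasurable (fun p : ℝ × ℝ => convGx (u p.1) p.2) (volume.restrict K) :=
    hu.aestronglyMeasurable_convGx.mono_measure (Measure.restrict_mono hψs le_rfl)
  set P : ℝ × ℝ → ℝ → ℝ × ℝ → ℝ := fun v k p =>
    fderiv ℝ ψ p v * r (k - W p) - ψ p * (deriv r (k - W p) * fderiv ℝ W p v) with hP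
  set I : ℝ → ℝ × ℝ → ℝ := fun k p => |u p.1 p.2 - k| * P (1, 0) k p
    + Real.sign (u p.1 p.2 - k) * (u p.1 p.2 ^ 2 / 2 - k ^ 2 / 2) * P (0, 1) k p
    + Real.sign (u p.1 p.2 - k) * convGx (u p.1) p.2 * (ψ p * r (k - W p)) with hI
  have hIk : ∀ k, 0 ≤ ∫ p in K, I k p := fun k => by
    have h := hu.entropy k (fun p => ψ p * r (k - W p)) (by fun_prop) (hψc.mul_right)
      ((tsupport_mul_subset_left).trans hψs) (fun p => mul_nonneg (hψ0 p) (hr0 _))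
    simp only [fderiv_mul_comp_const_sub hr hψ hW] at h
    rw [setIntegral_eq_of_subset_of_forall_sdiff_eq_zero
      (measurableSet_Ioi.prod MeasurableSet.univ) hψs] at h
    · exact h
    · rintro p ⟨-, hp⟩
      simp [hψz p hp, hψdz p hp]
  -- With `c` bounding `|W|` on `K`, this interval contains every `k` at which the test function or
  -- its derivatives can be nonzero. A bounded range of `k` makes the double integral absolutely
  -- convergent.
  set J := Icc (-(c + ε + 1)) (c + ε + 1)
  have hJ0 : ∀ p ∈ K, ∀ k, k ∉ J → ε < |k - W p| := fun p hp k hk => by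
    by_contra! h
    have h1 := hc p hp
    rw [Real.norm_eq_abs, abs_le] at h1
    rw [abs_le] at h
    exact hk ⟨by linarith, by linarith⟩
  have hds : ∀ s, ε < |s| → deriv r s = 0 := fun s hs => by
    have : r =ᶠ[𝓝 s] fun _ => 0 := by
      filter_upwards [(isOpen_lt continuous_const continuous_abs).mem_nhds hs] with y hy
      exact hrs y hy
    rw [this.deriv_eq, deriv_const]
  have hPc (v : ℝ × ℝ) : Continuous fun q : ℝ × (ℝ × ℝ) => P v q.1 q.2 := by
    have := hWd v
    have := hψd v
    simp only [hP]
    fun_prop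
  have hIint : Integrable (Function.uncurry I)
      ((volume.restrict J).prod ((volume : Measure (ℝ × ℝ)).restrict K)) := by
    have hU : AEMeasurable (fun q : ℝ × (ℝ × ℝ) => u q.2.1 q.2.2)
        ((volume.restrict J).prod ((volume : Measure (ℝ × ℝ)).restrict K)) :=
      (hum.comp_snd (μ := volume.restrict J)).aemeasurable
    have hF : AEMeasurable (fun q : ℝ × (ℝ × ℝ) => convGx (u q.2.1) q.2.2)
        ((volume.restrict J).prod ((volume : Measure (ℝ × ℝ)).restrict K)) :=
      (hFm.comp_snd (μ := volume.restrict J)).aemeasurable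
    have hS := measurable_sign.comp_aemeasurable (hU.sub measurable_fst.aemeasurable)
    have hJK : IsCompact (J ×ˢ K) := isCompact_Icc.prod hK
    obtain ⟨c1, hc1⟩ := hJK.exists_bound_of_continuousOn (hPc (1, 0)).continuousOn
    obtain ⟨c2, hc2⟩ := hJK.exists_bound_of_continuousOn (hPc (0, 1)).continuousOn
    obtain ⟨c3, hc3⟩ := hJK.exists_bound_of_continuousOn
      (f := fun q : ℝ × (ℝ × ℝ) => ψ q.2 * r (q.1 - W q.2))
      (Continuous.continuousOn (by fun_prop))
    refine Integrable.of_bound ?_ ((M + (c + ε + 1)) * c1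
      + 1 * (M ^ 2 / 2 + (c + ε + 1) ^ 2 / 2) * c2 + 1 * M * c3) ?_
    · refine AEMeasurable.aestronglyMeasurable ?_
      have hk : AEMeasurable (fun q : ℝ × (ℝ × ℝ) => q.1)
        ((volume.restrict J).prod ((volume : Measure (ℝ × ℝ)).restrict K)) :=
        measurable_fst.aemeasurable
      refine AEMeasurable.add (AEMeasurable.add ?_ ?_) ?_
      · exact (hU.sub hk).abs.mul (hPc (1, 0)).measurable.aemeasurable
      · exact (hS.mul (((hU.pow_const 2).div_const 2).sub ((hk.pow_const 2).div_const 2))).mul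
          (hPc (0, 1)).measurable.aemeasurable
      · exact (hS.mul hF).mul (Continuous.measurable (by fun_prop)).aemeasurable
    · have e1 : ∀ᵐ q ∂((volume.restrict J).prod ((volume : Measure (ℝ × ℝ)).restrict K)),
          q ∈ J ×ˢ K := by
        rw [Measure.prod_restrict]
        exact ae_restrict_mem (measurableSet_Icc.prod hKm)
      have e2 := (Measure.quasiMeasurePreserving_snd (μ := (volume : Measure ℝ).restrict J)
        (ν := (volume : Measure (ℝ × ℝ)).restrict K)).ae hM
      filter_upwards [e1, e2] with q hq hqM
      have b1 := hc1 q hq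
      have b2 := hc2 q hq
      have b3 := hc3 q hq
      have b4 := abs_sign_le_one (u q.2.1 q.2.2 - q.1)
      have b5 := hMF q.2 hq.2
      have b6 : |q.1| ≤ c + ε + 1 := abs_le.2 hq.1
      have b6' : 0 ≤ c + ε + 1 := (abs_nonneg _).trans b6
      have b7 : |u q.2.1 q.2.2 - q.1| ≤ M + (c + ε + 1) :=
        (abs_sub _ _).trans (add_le_add hqM b6)
      have b8 : |u q.2.1 q.2.2 ^ 2 / 2 - q.1 ^ 2 / 2| ≤ M ^ 2 / 2 + (c + ε + 1) ^ 2 / 2 := by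
        refine (abs_sub _ _).trans ?_
        rw [abs_div, abs_div, abs_pow, abs_pow, abs_two]
        gcongr
      simp only [Function.uncurry, hI]
      rw [Real.norm_eq_abs] at *
      refine (abs_add_three _ _ _).trans ?_
      rw [abs_mul, abs_mul, abs_mul, abs_mul, abs_mul, abs_abs]
      gcongr
  have hsub : ∀ᵐ p ∂((volume : Measure (ℝ × ℝ)).restrict K), p ∈ K := ae_restrict_mem hKm
  -- Each constant `k` gives a nonnegative integral over `K`; after integrating in `k` and
  -- exchanging the order, `integral_entropy_le` applies at each point `p`.
  have hswap := integral_integral_swap hIint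
  have h0 : 0 ≤ ∫ p in K, ∫ k in J, I k p := by
    rw [← hswap]
    exact integral_nonneg fun k => hIk k
  set G1 : ℝ × ℝ → ℝ := fun p => |u p.1 p.2 - W p| * fderiv ℝ ψ p (1, 0)
        + |u p.1 p.2 - W p| * ((u p.1 p.2 + W p) / 2) * fderiv ℝ ψ p (0, 1)
        + ψ p * |convGx (u p.1) p.2 - fderiv ℝ W p (1, 0) - W p * fderiv ℝ W p (0, 1)| with hG1
  set G2 : ℝ × ℝ → ℝ := fun p => |fderiv ℝ ψ p (1, 0)|
        + (|W p| + ε) * |fderiv ℝ ψ p (0, 1)| + ψ p * |fderiv ℝ W p (0, 1)| with hG2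
  have hG2i : IntegrableOn G2 K :=
    Continuous.continuousOn (by simp only [hG2]; fun_prop) |>.integrableOn_compact hK
  have hG1i : IntegrableOn G1 K := by
    obtain ⟨c1, hc1⟩ := hK.exists_bound_of_continuousOn hψt.continuousOn
    obtain ⟨c2, hc2⟩ := hK.exists_bound_of_continuousOn hψx.continuousOn
    obtain ⟨c3, hc3⟩ := hK.exists_bound_of_continuousOn hψcont.continuousOn
    obtain ⟨c4, hc4⟩ := hK.exists_bound_of_continuousOn
      (f := fun p => fderiv ℝ W p (1, 0) + W p * fderiv ℝ W p (0, 1))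
      (Continuous.continuousOn (by fun_prop))
    refine Integrable.of_bound ?_ ((M + c) * c1 + (M + c) * ((M + c) / 2) * c2 + c3 * (M + c4)) ?_
    · have hU := hum.aemeasurable
      have hF := hFm.aemeasurable
      have hWm := hWc.measurable.aemeasurable (μ := (volume : Measure (ℝ × ℝ)).restrict K)
      refine AEMeasurable.aestronglyMeasurable ?_
      refine AEMeasurable.add (AEMeasurable.add ?_ ?_) ?_
      · exact (hU.sub hWm).abs.mul hψt.measurable.aemeasurable
      · exact ((hU.sub hWm).abs.mul ((hU.add hWm).div_const 2)).mul hψx.measurable.aemeasurable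
      · exact hψcont.measurable.aemeasurable.mul ((hF.sub hWt.measurable.aemeasurable).sub
          (hWm.mul hWx.measurable.aemeasurable)).abs
    · filter_upwards [hM, hsub] with p hp hpK
      have b1 := hc1 p hpK
      have b2 := hc2 p hpK
      have b3 := hc3 p hpK
      have b4 := hc4 p hpK
      have b5 := hc p hpK
      have b6 := hMF p hpK
      rw [Real.norm_eq_abs] at *
      have b7 : |u p.1 p.2 - W p| ≤ M + c := (abs_sub _ _).trans (add_le_add hp b5)
      have b7' : 0 ≤ M + c := (abs_nonneg _).trans b7
      have b8 : |u p.1 p.2 + W p| ≤ M + c := (abs_add_le _ _).trans (add_le_add hp b5)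
      have b9 : |convGx (u p.1) p.2 - fderiv ℝ W p (1, 0) - W p * fderiv ℝ W p (0, 1)|
          ≤ M + c4 := by
        rw [sub_sub]
        exact (abs_sub _ _).trans (add_le_add b6 b4)
      simp only [hG1]
      refine (abs_add_three _ _ _).trans ?_
      rw [abs_mul, abs_mul, abs_mul, abs_mul, abs_abs, abs_abs, abs_div, abs_two]
      have b10 : 0 ≤ c3 := (abs_nonneg _).trans b3
      gcongr
  refine h0.trans ?_
  rw [← integral_const_mul, ← integral_add hG1i (hG2i.const_mul ε)]
  refine integral_mono_ae hIint.integral_prod_right (hG1i.add (hG2i.const_mul ε)) ?_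
  filter_upwards [hsub] with p hp
  have h1 := integral_entropy_le hε.le hr hr0 hr1 hrs (u p.1 p.2) (W p) (fderiv ℝ W p (1, 0))
    (fderiv ℝ W p (0, 1)) (convGx (u p.1) p.2) (ψ p) (fderiv ℝ ψ p (1, 0))
    (fderiv ℝ ψ p (0, 1)) (hψ0 p)
  have h2 : ∫ k in J, I k p = ∫ k, I k p :=
    setIntegral_eq_integral_of_forall_compl_eq_zero fun k hk => by
      have := hJ0 p hp k hk
      simp [hI, hP, hrs _ this, hds _ this]
  exact h2.trans_le h1

/-- The error integral in `entropy_variable_approx` stays bounded for `ε ≤ 1`, so its contribution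
vanishes as `ε → 0`. -/
theorem entropy_variable (hu : IsWeakEntropySolution ubar u) {W ψ : ℝ × ℝ → ℝ}
    (hW : ContDiff ℝ 1 W) (hψ : ContDiff ℝ 1 ψ) (hψc : HasCompactSupport ψ)
    (hψs : tsupport ψ ⊆ Ioi 0 ×ˢ univ) (hψ0 : ∀ p, 0 ≤ ψ p) :
    0 ≤ ∫ p : ℝ × ℝ in Ioi 0 ×ˢ univ, (|u p.1 p.2 - W p| * fderiv ℝ ψ p (1, 0)
        + |u p.1 p.2 - W p| * ((u p.1 p.2 + W p) / 2) * fderiv ℝ ψ p (0, 1)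
        + ψ p * |convGx (u p.1) p.2 - fderiv ℝ W p (1, 0) - W p * fderiv ℝ W p (0, 1)|) := by
  rw [setIntegral_eq_of_subset_of_forall_sdiff_eq_zero
      (measurableSet_Ioi.prod MeasurableSet.univ) hψs]
  · have h := fun (ε : ℝ) (hε : 0 < ε) => hu.entropy_variable_approx hW hψ hψc hψs hψ0 hε
    set A := ∫ p : ℝ × ℝ in tsupport ψ, (|u p.1 p.2 - W p| * fderiv ℝ ψ p (1, 0)
        + |u p.1 p.2 - W p| * ((u p.1 p.2 + W p) / 2) * fderiv ℝ ψ p (0, 1)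
        + ψ p * |convGx (u p.1) p.2 - fderiv ℝ W p (1, 0) - W p * fderiv ℝ W p (0, 1)|)
    have hKi {f : ℝ × ℝ → ℝ} (hf : Continuous f) : IntegrableOn f (tsupport ψ) :=
      hf.continuousOn.integrableOn_compact hψc
    have hWd (v : ℝ × ℝ) : Continuous fun p => fderiv ℝ W p v :=
      (hW.continuous_fderiv one_ne_zero).clm_apply continuous_const
    have hψd (v : ℝ × ℝ) : Continuous fun p => fderiv ℝ ψ p v :=
      (hψ.continuous_fderiv one_ne_zero).clm_apply continuous_const
    have hWx := hWd (0, 1)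
    have hψt := hψd (1, 0)
    have hψx := hψd (0, 1)
    have hWc := hW.continuous
    have hψcont := hψ.continuous
    set B := ∫ p : ℝ × ℝ in tsupport ψ, (|fderiv ℝ ψ p (1, 0)|
        + (|W p| + 1) * |fderiv ℝ ψ p (0, 1)| + ψ p * |fderiv ℝ W p (0, 1)|)
    have hB : ∀ ε : ℝ, 0 < ε → ε ≤ 1 → 0 ≤ A + ε * B := fun ε hε hε1 => by
      refine (h ε hε).trans ?_
      have : ∫ p : ℝ × ℝ in tsupport ψ, (|fderiv ℝ ψ p (1, 0)|
          + (|W p| + ε) * |fderiv ℝ ψ p (0, 1)| + ψ p * |fderiv ℝ W p (0, 1)|) ≤ B := by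
        refine integral_mono (hKi (by fun_prop)) (hKi (by fun_prop)) fun p => ?_
        dsimp only
        gcongr
      gcongr
    have ht : Tendsto (fun ε => A + ε * B) (𝓝[>] 0) (𝓝 (A + 0 * B)) :=
      (Continuous.tendsto (by fun_prop) 0).mono_left nhdsWithin_le_nhds
    rw [zero_mul, add_zero] at ht
    refine ge_of_tendsto ht ?_
    filter_upwards [Ioc_mem_nhdsGT (zero_lt_one' ℝ)] with ε hε
    exact hB ε hε.1 hε.2
  · rintro p ⟨-, hp⟩
    have h1 : fderiv ℝ ψ p = 0 :=
      image_eq_zero_of_notMem_tsupport fun h => hp (tsupport_fderiv_subset ℝ h)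
    simp [image_eq_zero_of_notMem_tsupport hp, h1]

end IsWeakEntropySolution

/-! ### Differential inequalities in the weak sense; cutoffs -/

/-- A smooth step from `0` to `1` whose derivative is a probability density. -/
theorem exists_smooth_step {ε : ℝ} (hε : 0 < ε) : ∃ r R : ℝ → ℝ, Continuous r ∧
    (∀ s, 0 ≤ r s) ∧ ∫ s, r s = 1 ∧ (∀ s, ε < |s| → r s = 0) ∧
    (∀ s, HasDerivAt R (r s) s) ∧ Monotone R ∧ (∀ s, s < -ε → R s = 0) ∧
    (∀ s, ε < s → R s = 1) := by
  obtain ⟨r, hr, hr0, hr1, hrs⟩ := exists_smooth_density hε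
  have hrc := hr.continuous
  have hd : ∀ s, HasDerivAt (fun t => ∫ x in (-ε - 1)..t, r x) (r s) s := fun s =>
    intervalIntegral.integral_hasDerivAt_right (hrc.intervalIntegrable _ _)
      hrc.stronglyMeasurable.stronglyMeasurableAtFilter hrc.continuousAt
  have hz : ∀ s, s < -ε → ∫ x in (-ε - 1)..s, r x = 0 := fun s hs => by
    rw [intervalIntegral.integral_congr (g := fun _ => 0)]
    · simp
    · intro x hx
      have h1 : x < -ε := hx.2.trans_lt (max_lt (by linarith) hs)
      exact hrs x (by rw [abs_of_neg (by linarith)]; linarith)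
  refine ⟨r, fun t => ∫ x in (-ε - 1)..t, r x, hrc, hr0, hr1, hrs, hd, ?_, hz, fun s hs => ?_⟩
  · refine monotone_of_deriv_nonneg (fun s => (hd s).differentiableAt) fun s => ?_
    rw [(hd s).deriv]
    exact hr0 s
  · change ∫ x in (-ε - 1)..s, r x = 1
    rw [intervalIntegral.integral_of_le (by linarith)]
    refine Eq.trans ?_ hr1
    refine setIntegral_eq_integral_of_forall_compl_eq_zero fun x hx => ?_
    by_cases h : x ≤ -ε - 1
    · exact hrs x (by rw [abs_of_neg (by linarith)]; linarith)
    · have : s < x := by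
        by_contra! h'
        exact hx ⟨lt_of_not_ge h, h'⟩
      exact hrs x (by rw [abs_of_pos (by linarith)]; linarith)

theorem integral_density_mul_le {r A : ℝ → ℝ} {ε c s : ℝ} (hr : Continuous r)
    (hr0 : ∀ s, 0 ≤ r s) (hr1 : ∫ s, r s = 1) (hrs : ∀ s, ε < |s| → r s = 0) (hA : Continuous A)
    (hc : ∀ t, |t - s| ≤ ε → A t ≤ c) : ∫ t, r (t - s) * A t ≤ c := by
  have hcs : HasCompactSupport fun t => r (t - s) := by
    refine HasCompactSupport.intro (isCompact_Icc (a := s - ε) (b := s + ε)) fun t ht => ?_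
    refine hrs _ ?_
    by_contra! h
    rw [abs_le] at h
    exact ht ⟨by linarith, by linarith⟩
  have h1 : ∫ t, r (t - s) * A t ≤ ∫ t, r (t - s) * c := by
    refine integral_mono (Continuous.integrable_of_hasCompactSupport (by fun_prop)
      hcs.mul_right) (Continuous.integrable_of_hasCompactSupport (by fun_prop)
      hcs.mul_right) fun t => ?_
    rcases le_or_gt |t - s| ε with h | h
    · exact mul_le_mul_of_nonneg_left (hc t h) (hr0 _)
    · simp [hrs _ h]
  rwa [integral_mul_const, integral_sub_right_eq_self (fun t => r t), hr1, one_mul] at h1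

/-- A continuous function whose distributional derivative is at most `β`. -/
theorem le_add_of_forall_test {A : ℝ → ℝ} {a b β : ℝ} (hA : Continuous A) (hab : a < b)
    (hβ : 0 ≤ β)
    (h : ∀ θ : ℝ → ℝ, ContDiff ℝ 1 θ → (∀ t, 0 ≤ θ t) → HasCompactSupport θ →
      tsupport θ ⊆ Ioo a b → 0 ≤ ∫ t, (deriv θ t * A t + θ t * β)) :
    A b ≤ A a + (b - a) * β := by
  have key : ∀ s ∈ Ioo a b, ∀ t ∈ Ioo a b, s < t → A t ≤ A s + (t - s) * β := by
    intro s hs t ht hst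
    refine le_of_forall_pos_le_add fun η hη => ?_
    obtain ⟨δ1, hδ1, h1⟩ := Metric.continuous_iff.1 hA s (η / 4) (by positivity)
    obtain ⟨δ2, hδ2, h2⟩ := Metric.continuous_iff.1 hA t (η / 4) (by positivity)
    -- The last condition gives `2 ε β ≤ η / 2`, which pays for the mass of `θ` beyond length `t -
    -- s`; continuity of `A` at `s` and `t` uses the other half of `η`.
    obtain ⟨ε, hε, hε1⟩ : ∃ ε > 0, ε < δ1 ∧ ε < δ2 ∧ ε < s - a ∧ ε < b - t ∧
        ε * (4 * (β + 1)) ≤ η := by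
      have hs1 := sub_pos.2 hs.1
      have ht2 := sub_pos.2 ht.2
      refine ⟨min (min (δ1 / 2) (δ2 / 2)) (min (min ((s - a) / 2) ((b - t) / 2))
        (η / (4 * (β + 1)))), by positivity, ?_, ?_, ?_, ?_, ?_⟩
      · exact ((min_le_left _ _).trans (min_le_left _ _)).trans_lt (by linarith)
      · exact ((min_le_left _ _).trans (min_le_right _ _)).trans_lt (by linarith)
      · exact ((min_le_right _ _).trans ((min_le_left _ _).trans (min_le_left _ _))).trans_lt
          (by linarith)
      · exact ((min_le_right _ _).trans ((min_le_left _ _).trans (min_le_right _ _))).trans_lt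
          (by linarith)
      · rw [← le_div_iff₀ (by positivity)]
        exact (min_le_right _ _).trans (min_le_right _ _)
    obtain ⟨e1, e2, e3, e4, e5⟩ := hε1
    obtain ⟨r, R, hrc, hr0, hr1, hrs, hR, hRm, hRz, hRo⟩ := exists_smooth_step hε
    have hR0 : ∀ x, 0 ≤ R x := fun x => by
      rw [← hRz (min x (-ε - 1)) ((min_le_right _ _).trans_lt (by linarith))]
      exact hRm (min_le_left _ _)
    have hR1 : ∀ x, R x ≤ 1 := fun x => by
      rw [← hRo (max x (ε + 1)) (lt_of_lt_of_le (by linarith) (le_max_right _ _))]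
      exact hRm (le_max_left _ _)
    -- A smoothed indicator of `[s, t]`: its derivative is a bump at `s` minus a bump at `t`.
    set θ : ℝ → ℝ := fun x => R (x - s) - R (x - t)
    have hθd : ∀ x, HasDerivAt θ (r (x - s) - r (x - t)) x := fun x =>
      ((hR (x - s)).comp_sub_const x s).sub ((hR (x - t)).comp_sub_const x t)
    have hdθ : deriv θ = fun x => r (x - s) - r (x - t) := funext fun x => (hθd x).deriv
    have hθ1 : ContDiff ℝ 1 θ := by
      refine contDiff_one_iff_deriv.2 ⟨fun x => (hθd x).differentiableAt, ?_⟩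
      rw [hdθ]
      fun_prop
    have hθ0 : ∀ x, 0 ≤ θ x := fun x => sub_nonneg.2 (hRm (by linarith))
    have hθle : ∀ x, θ x ≤ 1 := fun x => by
      have := hR1 (x - s)
      have := hR0 (x - t)
      simp only [θ]
      linarith
    have hθz : ∀ x, x ∉ Icc (s - ε) (t + ε) → θ x = 0 := fun x hx => by
      by_cases h' : s - ε ≤ x
      · have : t + ε < x := by
          by_contra! h''
          exact hx ⟨h', h''⟩
        simp only [θ]
        rw [hRo _ (by linarith), hRo _ (by linarith), sub_self]
      · simp only [θ]
        rw [hRz _ (by linarith), hRz _ (by linarith), sub_self]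
    have hθs : tsupport θ ⊆ Icc (s - ε) (t + ε) := by
      refine closure_minimal (fun x hx => ?_) isClosed_Icc
      by_contra h'
      exact hx (hθz x h')
    have hθc : HasCompactSupport θ := HasCompactSupport.intro isCompact_Icc hθz
    have h3 := h θ hθ1 hθ0 hθc (hθs.trans fun x hx => ⟨by linarith [hx.1], by linarith [hx.2]⟩)
    have hθcont := hθ1.continuous
    have hcs (z : ℝ) : Integrable fun x => r (x - z) * A x := by
      refine Continuous.integrable_of_hasCompactSupport (by fun_prop) (HasCompactSupport.mul_right ?_)
      refine HasCompactSupport.intro (isCompact_Icc (a := z - ε) (b := z + ε)) fun x hx => ?_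
      refine hrs _ ?_
      by_contra! h
      rw [abs_le] at h
      exact hx ⟨by linarith, by linarith⟩
    have hθi : Integrable fun x => θ x * β :=
      Continuous.integrable_of_hasCompactSupport (by fun_prop) hθc.mul_right
    have h4 : ∫ x, θ x * β ≤ (t - s + 2 * ε) * β := by
      rw [integral_mul_const]
      refine mul_le_mul_of_nonneg_right ?_ hβ
      rw [← setIntegral_eq_integral_of_forall_compl_eq_zero hθz]
      calc ∫ x in Icc (s - ε) (t + ε), θ x ≤ ∫ x in Icc (s - ε) (t + ε), (1 : ℝ) :=
            integral_mono hθcont.integrableOn_Icc (integrableOn_const (by simp)) hθle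
        _ = t - s + 2 * ε := by
            simp
            rw [max_eq_left (by linarith)]
            ring
    have h5 : ∫ x, (deriv θ x * A x + θ x * β)
        = (∫ x, r (x - s) * A x) - (∫ x, r (x - t) * A x) + ∫ x, θ x * β := by
      have hi : Integrable fun x => r (x - s) * A x - r (x - t) * A x := (hcs s).sub (hcs t)
      rw [← integral_sub (hcs s) (hcs t), ← integral_add hi hθi]
      refine integral_congr_ae (Eventually.of_forall fun x => ?_)
      simp only [hdθ]
      ring
    have h6 : ∫ x, r (x - s) * A x ≤ A s + η / 4 :=
      integral_density_mul_le hrc hr0 hr1 hrs hA fun x hx => by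
        have := h1 x (by rw [Real.dist_eq]; linarith)
        rw [Real.dist_eq] at this
        linarith [(abs_lt.1 this).2]
    have h7 : ∫ x, r (x - t) * (-A x) ≤ -A t + η / 4 :=
      integral_density_mul_le hrc hr0 hr1 hrs hA.neg fun x hx => by
        have := h2 x (by rw [Real.dist_eq]; linarith)
        rw [Real.dist_eq] at this
        linarith [(abs_lt.1 this).1]
    simp only [mul_neg, integral_neg] at h7
    nlinarith
  -- Test functions live in the open interval, so the endpoints are reached by continuity.
  have hm : ∀ᶠ x in 𝓝[>] (0 : ℝ), A (b - x) ≤ A (a + x) + (b - x - (a + x)) * β := by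
    filter_upwards [Ioo_mem_nhdsGT (show (0 : ℝ) < (b - a) / 2 by linarith)] with x hx
    have := hx.1
    have := hx.2
    refine key _ ⟨?_, ?_⟩ _ ⟨?_, ?_⟩ ?_ <;> linarith
  have l1 : Tendsto (fun x => A (b - x)) (𝓝[>] 0) (𝓝 (A (b - 0))) :=
    (Continuous.tendsto (by fun_prop) 0).mono_left nhdsWithin_le_nhds
  have l2 : Tendsto (fun x => A (a + x) + (b - x - (a + x)) * β) (𝓝[>] 0)
      (𝓝 (A (a + 0) + (b - 0 - (a + 0)) * β)) :=
    (Continuous.tendsto (by fun_prop) 0).mono_left nhdsWithin_le_nhds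
  simpa using le_of_tendsto_of_tendsto l1 l2 hm

theorem integrable_cutoff_mul {f : ℝ × ℝ → ℝ} {g : ℝ → ℝ} {s : Set ℝ} {c : ℝ}
    (hf : AEStronglyMeasurable f (volume.restrict (Ioi 0 ×ˢ univ))) (hg : Continuous g)
    (hgc : HasCompactSupport g) (hgs : ∀ t ∉ s, g t = 0)
    (hfi : ∀ t ∈ s, Integrable fun x => f (t, x)) (hfc : ∀ t ∈ s, ∫ x, |f (t, x)| ≤ c) :
    Integrable (fun p : ℝ × ℝ => g p.1 * f p) (volume.restrict (Ioi 0 ×ˢ univ)) := by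
  rw [restrict_Ioi_prod_univ] at hf ⊢
  have hm : AEStronglyMeasurable (fun p : ℝ × ℝ => g p.1 * f p)
      ((volume.restrict (Ioi 0)).prod volume) :=
    (hg.comp continuous_fst).aestronglyMeasurable.mul hf
  refine (integrable_prod_iff hm).2 ⟨Eventually.of_forall fun t => ?_, ?_⟩
  · by_cases ht : t ∈ s
    · exact (hfi t ht).const_mul (g t)
    · simp [hgs t ht]
  · refine ((hg.integrable_of_hasCompactSupport hgc).abs.mul_const c).integrableOn.mono'
      hm.norm.integral_prod_right' (Eventually.of_forall fun t => ?_)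
    by_cases ht : t ∈ s
    · simp only [norm_mul, Real.norm_eq_abs, integral_const_mul, abs_abs]
      rw [abs_of_nonneg (integral_nonneg fun x => abs_nonneg _)]
      exact mul_le_mul_of_nonneg_left (hfc t ht) (abs_nonneg _)
    · simp [hgs t ht]

/-- Smooth functions of `x` with values in `[0, 1]` that increase to `1`, with derivatives
tending to zero uniformly. -/
theorem exists_cutoff_seq : ∃ (χ χ' : ℕ → ℝ → ℝ) (C : ℝ), 0 ≤ C ∧ (∀ n, ContDiff ℝ 1 (χ n)) ∧
    (∀ n x, HasDerivAt (χ n) (χ' n x) x) ∧ (∀ n, HasCompactSupport (χ n)) ∧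
    (∀ n x, 0 ≤ χ n x) ∧ (∀ n x, χ n x ≤ 1) ∧ (∀ n x, |χ' n x| ≤ C) ∧
    (∀ x, Tendsto (fun n => χ n x) atTop (𝓝 1)) ∧
    ∀ x, Tendsto (fun n => χ' n x) atTop (𝓝 0) := by
  obtain ⟨f, hf1, hfc, hf0, hfle, hfo⟩ : ∃ f : ℝ → ℝ, ContDiff ℝ 1 f ∧ HasCompactSupport f ∧
      (∀ x, 0 ≤ f x) ∧ (∀ x, f x ≤ 1) ∧ f 0 = 1 := by
    let f : ContDiffBump (0 : ℝ) := ⟨1, 2, by norm_num, by norm_num⟩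
    exact ⟨f, f.contDiff, f.hasCompactSupport, fun x => f.nonneg, fun x => f.le_one,
      f.one_of_mem_closedBall (by simp [f])⟩
  have hfd : Continuous (deriv f) := hf1.continuous_deriv le_rfl
  obtain ⟨C, hC⟩ := hfc.deriv.exists_bound_of_continuous hfd
  have hC0 : 0 ≤ C := (norm_nonneg _).trans (hC 0)
  have hpos : ∀ n : ℕ, (0 : ℝ) < 1 / (n + 1) := fun n => Nat.one_div_pos_of_nat
  have h0 : Tendsto (fun n : ℕ => (1 : ℝ) / (n + 1)) atTop (𝓝 0) :=
    tendsto_one_div_add_atTop_nhds_zero_nat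
  have hb : ∀ (n : ℕ) x, |1 / ((n : ℝ) + 1) * deriv f (1 / ((n : ℝ) + 1) * x)|
      ≤ 1 / ((n : ℝ) + 1) * C := fun n x => by
    rw [abs_mul, abs_of_pos (hpos n)]
    exact mul_le_mul_of_nonneg_left (hC _) (hpos n).le
  refine ⟨fun n x => f (1 / ((n : ℝ) + 1) * x),
    fun n x => 1 / ((n : ℝ) + 1) * deriv f (1 / ((n : ℝ) + 1) * x), C, hC0, fun n => ?_,
    fun n x => ?_, fun n => ?_, fun n x => hf0 _, fun n x => hfle _, fun n x => ?_,
    fun x => ?_, fun x => ?_⟩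
  · exact hf1.comp (contDiff_const.mul contDiff_id)
  · have h1 := (hf1.differentiable one_ne_zero (1 / ((n : ℝ) + 1) * x)).hasDerivAt.comp x
      ((hasDerivAt_id x).const_mul (1 / ((n : ℝ) + 1)))
    refine h1.congr_deriv ?_
    ring
  · simpa only [smul_eq_mul] using hfc.comp_smul (hpos n).ne'
  · refine (hb n x).trans ?_
    have : 1 / ((n : ℝ) + 1) ≤ 1 := by
      rw [div_le_one (by positivity)]
      linarith [(n.cast_nonneg : (0 : ℝ) ≤ n)]
    nlinarith
  · have h1 := hf1.continuous.tendsto 0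
    rw [hfo] at h1
    refine h1.comp ?_
    simpa using h0.mul_const x
  · refine squeeze_zero_norm (hb · x) ?_
    simpa using h0.mul_const C

theorem fderiv_prod_mul {θ χ : ℝ → ℝ} {θ' χ' : ℝ} {p : ℝ × ℝ} (hθ : HasDerivAt θ θ' p.1)
    (hχ : HasDerivAt χ χ' p.2) (v : ℝ × ℝ) :
    fderiv ℝ (fun p : ℝ × ℝ => θ p.1 * χ p.2) p v = θ' * v.1 * χ p.2 + θ p.1 * (χ' * v.2) := by
  have h1 := hθ.comp_hasFDerivAt p (hasFDerivAt_fst (𝕜 := ℝ) (E := ℝ) (F := ℝ))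
  have h2 := hχ.comp_hasFDerivAt p (hasFDerivAt_snd (𝕜 := ℝ) (E := ℝ) (F := ℝ))
  refine (congrArg (fun T : ℝ × ℝ →L[ℝ] ℝ => T v) (h1.mul h2).fderiv).trans ?_
  simp
  ring

/-! ### Comparison of the solution with one step -/

theorem IsC1Profile.tendsto_advect {w : ℝ → ℝ} {L : ℝ} (h : IsC1Profile w L) (a s : ℝ)
    (S : Set ℝ) (hS : ∀ t ∈ S, a ≤ t) (hs : s ∈ S) :
    Tendsto (fun t => ∫ x, |advect w (t - a) x - advect w (s - a) x|) (𝓝[S] s) (𝓝 0) := by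
  have h0 : Tendsto (fun t => |t - s| * ∫ x, stepSpeed w L x) (𝓝[S] s) (𝓝 0) := by
    have : Tendsto (fun t => |t - s| * ∫ x, stepSpeed w L x) (𝓝 s)
        (𝓝 (|s - s| * ∫ x, stepSpeed w L x)) := Continuous.tendsto (by fun_prop) s
    simp only [sub_self, abs_zero, zero_mul] at this
    exact this.mono_left nhdsWithin_le_nhds
  refine squeeze_zero' (Eventually.of_forall fun t => integral_nonneg fun x => abs_nonneg _) ?_ h0
  filter_upwards [self_mem_nhdsWithin] with t ht
  rw [← integral_const_mul]
  refine integral_mono ((h.advect_isC1Profile (sub_nonneg.2 (hS t ht))).integrable.sub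
    (h.advect_isC1Profile (sub_nonneg.2 (hS s hs))).integrable).abs
    (h.integrable_stepSpeed.const_mul _) fun x => ?_
  have := h.abs_advect_sub_le (s - a) (t - a) x
  rwa [sub_sub_sub_cancel_right] at this

namespace IsWeakEntropySolution

variable {ubar : ℝ → ℝ} {u : ℝ → ℝ → ℝ} {w : ℝ → ℝ} {L a b : ℝ}

theorem continuousOn_integral_abs_sub_advect (hu : IsWeakEntropySolution ubar u)
    (hw : IsC1Profile w L) (ha : 0 ≤ a) :
    ContinuousOn (fun t => ∫ x, |u t x - advect w (t - a) x|) (Icc a b) :=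
  continuousOn_integral_abs_sub (w := fun t x => advect w (t - a) x)
    (fun _ ht => hu.integrable _ (ha.trans ht.1))
    (fun _ ht => (hw.advect_isC1Profile (sub_nonneg.2 ht.1)).integrable)
    (fun s hs => (hu.continuous_L1 s (ha.trans hs.1)).mono_left
      (nhdsWithin_mono s fun _ ht => ha.trans ht.1))
    (fun s hs => hw.tendsto_advect a s _ (fun _ ht => ht.1) hs)

/-- The comparison inequality between `u` and `advect w`, tested against a function of time. -/
theorem advect_test (hu : IsWeakEntropySolution ubar u) (hw : IsC1Profile w L) (ha : 0 ≤ a)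
    (hb1 : b ≤ a + 1) {β : ℝ}
    (hβ : ∀ t ∈ Icc a b, ∫ x, |u t x - w x| ≤ β) {θ : ℝ → ℝ} (hθ : ContDiff ℝ 1 θ)
    (hθ0 : ∀ t, 0 ≤ θ t) (hθc : HasCompactSupport θ) (hθs : tsupport θ ⊆ Ioo a b) :
    0 ≤ ∫ t, (deriv θ t * (∫ x, |u t x - advect w (t - a) x|)
      + θ t * (β + (b - a) * ∫ x, stepDefect w L x)) := by
  obtain ⟨χ, χ', C, hC0, hχ1, hχd, hχc, hχ0, hχle, hχ'C, hχt, hχ't⟩ := exists_cutoff_seq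
  set W : ℝ × ℝ → ℝ := fun p => advect w (p.1 - a) p.2 with hWdef
  have hW : ContDiff ℝ 1 W := hw.contDiff_advect_prod a
  set μ := (volume : Measure (ℝ × ℝ)).restrict (Ioi 0 ×ˢ univ) with hμ
  have hθcont := hθ.continuous
  have hθd : Continuous (deriv θ) := hθ.continuous_deriv le_rfl
  have hWc := hW.continuous
  have hWd (v : ℝ × ℝ) : Continuous fun p => fderiv ℝ W p v :=
    (hW.continuous_fderiv one_ne_zero).clm_apply continuous_const
  have hWt := hWd (1, 0)
  have hWx := hWd (0, 1)
  have hθz : ∀ t ∉ tsupport θ, θ t = 0 := fun t ht => image_eq_zero_of_notMem_tsupport ht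
  have hθdz : ∀ t ∉ tsupport θ, deriv θ t = 0 := fun t ht =>
    image_eq_zero_of_notMem_tsupport fun h => ht (tsupport_deriv_subset h)
  have hsub : ∀ t ∈ tsupport θ, t ∈ Icc a b := fun t ht => Ioo_subset_Icc_self (hθs ht)
  have hχ'eq : ∀ n, χ' n = deriv (χ n) := fun n => funext fun x => ((hχd n x).deriv).symm
  have hχ'c : ∀ n, Continuous (χ' n) := fun n => by
    rw [hχ'eq]
    exact (hχ1 n).continuous_deriv le_rfl
  set res : ℝ × ℝ → ℝ := fun p =>
    |convGx (u p.1) p.2 - fderiv ℝ W p (1, 0) - W p * fderiv ℝ W p (0, 1)| with hres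
  set R : ℝ × ℝ → ℝ := fun p =>
    |convGx (u p.1) p.2 - convGx w p.2| + (b - a) * stepDefect w L p.2 with hR
  have hresR : ∀ p : ℝ × ℝ, p.1 ∈ Icc a b → res p ≤ R p := fun p hp => by
    have h1 := hw.abs_residual_le (p := p) hp.1 (hp.2.trans hb1)
    have h2 : 0 ≤ stepDefect w L p.2 := by
      have := hw.nonneg
      have := hw.stepSpeed_nonneg p.2
      unfold stepDefect
      positivity
    have h3 : (p.1 - a) * stepDefect w L p.2 ≤ (b - a) * stepDefect w L p.2 :=
      mul_le_mul_of_nonneg_right (by linarith [hp.2]) h2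
    have e : convGx (u p.1) p.2 - fderiv ℝ W p (1, 0) - W p * fderiv ℝ W p (0, 1)
        = (convGx (u p.1) p.2 - convGx w p.2)
          + (convGx w p.2 - fderiv ℝ W p (1, 0) - W p * fderiv ℝ W p (0, 1)) := by ring
    simp only [hres, hR, e]
    exact (abs_add_le _ _).trans (add_le_add le_rfl (h1.trans h3))
  have hD0 := hu.continuousOn_integral_abs_sub_advect (b := b) hw ha
  obtain ⟨cD, hcD⟩ := isCompact_Icc.exists_bound_of_continuousOn hD0
  have hUm : AEStronglyMeasurable (fun p : ℝ × ℝ => u p.1 p.2) μ := hu.aestronglyMeasurable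
  have hFm : AEStronglyMeasurable (fun p : ℝ × ℝ => convGx (u p.1) p.2) μ :=
    hu.aestronglyMeasurable_convGx
  have hDm : AEStronglyMeasurable (fun p : ℝ × ℝ => |u p.1 p.2 - W p|) μ :=
    (hUm.sub hWc.aestronglyMeasurable).norm
  have hresm : AEStronglyMeasurable res μ :=
    ((hFm.sub hWt.aestronglyMeasurable).sub (hWc.mul hWx).aestronglyMeasurable).norm
  have hGw := contDiff_convGx hw.contDiff hw.integrable hw.abs_deriv_le
  have hDefc : Continuous (stepDefect w L) := by
    have := hw.contDiff.continuous
    have := hGw.continuous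
    unfold stepDefect stepSpeed
    fun_prop
  have hRm : AEStronglyMeasurable R μ :=
    ((hFm.sub (hGw.continuous.comp continuous_snd).aestronglyMeasurable).norm).add
      (continuous_const.mul (hDefc.comp continuous_snd)).aestronglyMeasurable
  have hDi : ∀ t ∈ Icc a b, Integrable fun x => |u t x - advect w (t - a) x| := fun t ht =>
    ((hu.integrable t (ha.trans ht.1)).sub
      (hw.advect_isC1Profile (sub_nonneg.2 ht.1)).integrable).abs
  have hRi1 : ∀ t ∈ Icc a b, Integrable fun x => |convGx (u t) x - convGx w x| := fun t ht =>
    ((integrable_convGx (hu.integrable t (ha.trans ht.1))).sub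
      (integrable_convGx hw.integrable)).abs
  have hRi : ∀ t ∈ Icc a b, Integrable fun x => R (t, x) := fun t ht =>
    (hRi1 t ht).add (hw.integrable_stepDefect.const_mul _)
  have hRint : ∀ t ∈ Icc a b, ∫ x, R (t, x) ≤ β + (b - a) * ∫ x, stepDefect w L x :=
    fun t ht => by
      have hut := hu.integrable t (ha.trans ht.1)
      simp only [hR]
      rw [integral_add (hRi1 t ht) (hw.integrable_stepDefect.const_mul _), integral_const_mul]
      gcongr
      refine le_trans ?_ (hβ t ht)
      have h1 := integral_abs_convGx_le (hut.sub hw.integrable)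
      have h2 : convGx (u t - w) = fun x => convGx (u t) x - convGx w x :=
        funext fun x => convGx_sub hut hw.integrable x
      rw [h2] at h1
      exact h1
  have hR0 : ∀ p ∈ Icc a b ×ˢ (univ : Set ℝ), 0 ≤ R p := fun p hp =>
    (abs_nonneg _).trans (hresR p hp.1)
  have iD (g : ℝ → ℝ) (hg : Continuous g) (hgz : ∀ t ∉ tsupport θ, g t = 0) :
      Integrable (fun p : ℝ × ℝ => g p.1 * |u p.1 p.2 - W p|) μ := by
    refine integrable_cutoff_mul (s := tsupport θ) (c := cD) hDm hg
      (HasCompactSupport.intro hθc hgz) hgz (fun t ht => hDi t (hsub t ht)) fun t ht => ?_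
    have := hcD t (hsub t ht)
    simp only [abs_abs]
    exact (le_abs_self _).trans this
  have iR : Integrable (fun p : ℝ × ℝ => θ p.1 * R p) μ := by
    refine integrable_cutoff_mul (s := tsupport θ) (c := β + (b - a) * ∫ x, stepDefect w L x)
      hRm hθcont hθc hθz (fun t ht => hRi t (hsub t ht)) fun t ht => ?_
    refine le_trans (le_of_eq ?_) (hRint t (hsub t ht))
    exact integral_congr_ae (Eventually.of_forall fun x =>
      abs_of_nonneg (hR0 (t, x) ⟨hsub t ht, mem_univ _⟩))
  have hψfd : ∀ (n : ℕ) (p v : ℝ × ℝ), fderiv ℝ (fun p : ℝ × ℝ => θ p.1 * χ n p.2) p v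
      = deriv θ p.1 * v.1 * χ n p.2 + θ p.1 * (χ' n p.2 * v.2) := fun n p v =>
    fderiv_prod_mul (hθ.differentiable one_ne_zero p.1).hasDerivAt (hχd n p.2) v
  set f : ℕ → ℝ × ℝ → ℝ := fun n p => |u p.1 p.2 - W p| * (deriv θ p.1 * χ n p.2)
    + |u p.1 p.2 - W p| * ((u p.1 p.2 + W p) / 2) * (θ p.1 * χ' n p.2)
    + θ p.1 * χ n p.2 * res p with hf
  have hf0 : ∀ n, 0 ≤ ∫ p, f n p ∂μ := fun n => by
    have hcs : tsupport (fun p : ℝ × ℝ => θ p.1 * χ n p.2) ⊆ tsupport θ ×ˢ tsupport (χ n) := by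
      refine closure_minimal (fun p hp => ?_)
        ((isClosed_tsupport _).prod (isClosed_tsupport _))
      exact ⟨subset_tsupport _ (left_ne_zero_of_mul hp), subset_tsupport _
        (right_ne_zero_of_mul hp)⟩
    have h1 := hu.entropy_variable hW (ψ := fun p : ℝ × ℝ => θ p.1 * χ n p.2)
      ((hθ.comp contDiff_fst).mul ((hχ1 n).comp contDiff_snd))
      ((IsCompact.prod hθc (hχc n)).of_isClosed_subset (isClosed_tsupport _) hcs)
      (fun p hp => ⟨ha.trans_lt (hθs (hcs hp).1).1, mem_univ _⟩)
      (fun p => mul_nonneg (hθ0 _) (hχ0 n _))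
    simp only [hψfd, mul_one, mul_zero, add_zero, zero_mul, zero_add] at h1
    exact h1
  -- Sup bounds on `u` hold only away from `t = 0`. Even for `a = 0` the support of `θ` starts at a
  -- positive time `a'`, which suffices.
  obtain ⟨M, hM⟩ : ∃ M, 0 ≤ M ∧ ∀ᵐ p ∂μ, p.1 ∈ tsupport θ → |(u p.1 p.2 + W p) / 2| ≤ M := by
    rcases (tsupport θ).eq_empty_or_nonempty with he | hne
    · exact ⟨0, le_rfl, by simp [he]⟩
    obtain ⟨a', ha', hmin⟩ := IsCompact.exists_isMinOn hθc hne continuousOn_id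
    have ha'0 : 0 < a' := ha.trans_lt (hθs ha').1
    obtain ⟨M, hM⟩ := hu.locallyBounded a' b ha'0
    have hM' := (ae_restrict_iff' (measurableSet_Icc.prod MeasurableSet.univ)).1 hM
    set N := L + (∫ x, |w x|) + (L * (L + ∫ x, |w x|) + ∫ x, |w x|)
    refine ⟨max M 0 + max N 0, by positivity, ?_⟩
    filter_upwards [ae_restrict_of_ae hM'] with p hp hpt
    have h1 := hp ⟨⟨hmin hpt, (hsub _ hpt).2⟩, mem_univ _⟩
    have h2 : |W p| ≤ N := by
      have ht := hsub _ hpt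
      refine (hw.abs_advect_le (sub_nonneg.2 ht.1) p.2).trans ?_
      have h3 := hw.stepSpeed_nonneg p.2
      have h4 := hw.abs_le p.2
      have h5 := mul_le_mul_of_nonneg_left h4 hw.nonneg
      have h6 := abs_convGx_le_integral hw.integrable p.2
      have h7 : (p.1 - a) * stepSpeed w L p.2 ≤ 1 * stepSpeed w L p.2 :=
        mul_le_mul_of_nonneg_right (by linarith [ht.2]) h3
      have h8 : stepSpeed w L p.2 = L * |w p.2| + |convGx w p.2| := rfl
      linarith
    rw [abs_div, abs_two]
    have h9 := abs_add_le (u p.1 p.2) (W p)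
    have := le_max_left M 0
    have := le_max_left N 0
    have := le_max_right M 0
    have := le_max_right N 0
    linarith
  -- The flux term disappears as the spatial cutoff widens: `χ' n` tends to `0`, `u - W` is
  -- integrable in `x`, and `u + W` is bounded on the support of `θ`.
  have hlim : Tendsto (fun n => ∫ p, f n p ∂μ) atTop
      (𝓝 (∫ p, (deriv θ p.1 * |u p.1 p.2 - W p| + θ p.1 * res p) ∂μ)) := by
    refine tendsto_integral_of_dominated_convergence (fun p =>
      |deriv θ p.1| * |u p.1 p.2 - W p| + M * C * (θ p.1 * |u p.1 p.2 - W p|) + θ p.1 * R p)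
      (fun n => ?_) (((iD _ hθd.abs fun t ht => by simp [hθdz t ht]).add
        ((iD _ hθcont hθz).const_mul _)).add iR) (fun n => ?_) ?_
    · have := hχ'c n
      have := (hχ1 n).continuous
      refine ((hDm.mul ?_).add ((hDm.mul ?_).mul ?_)).add (AEStronglyMeasurable.mul ?_ hresm)
      · exact Continuous.aestronglyMeasurable (by fun_prop)
      · simp only [div_eq_mul_inv]
        exact (hUm.add hWc.aestronglyMeasurable).mul_const _
      · exact Continuous.aestronglyMeasurable (by fun_prop)
      · exact Continuous.aestronglyMeasurable (by fun_prop)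
    · filter_upwards [hM.2] with p hp
      by_cases ht : p.1 ∈ tsupport θ
      · have h1 := hp ht
        have h2 := hresR p (hsub _ ht)
        have h3 := hχ'C n p.2
        have h4 := hχle n p.2
        have h5 := hχ0 n p.2
        have h6 := hθ0 p.1
        have h7 : 0 ≤ res p := abs_nonneg _
        have h8 := hM.1
        simp only [hf, Real.norm_eq_abs]
        refine (abs_add_three _ _ _).trans ?_
        simp only [abs_mul, abs_abs, abs_of_nonneg h5, abs_of_nonneg h6, abs_of_nonneg h7]
        have t1 : |u p.1 p.2 - W p| * (|deriv θ p.1| * χ n p.2)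
            ≤ |u p.1 p.2 - W p| * (|deriv θ p.1| * 1) := by gcongr
        have t2 : |u p.1 p.2 - W p| * |(u p.1 p.2 + W p) / 2| * (θ p.1 * |χ' n p.2|)
            ≤ |u p.1 p.2 - W p| * M * (θ p.1 * C) := by gcongr
        have t3 : θ p.1 * χ n p.2 * res p ≤ θ p.1 * 1 * R p := by gcongr
        linarith
      · simp [hf, hθz _ ht, hθdz _ ht]
    · refine Eventually.of_forall fun p => ?_
      have h1 := (((hχt p.2).const_mul (deriv θ p.1)).const_mul |u p.1 p.2 - W p|).add
        (((hχ't p.2).const_mul (θ p.1)).const_mul (|u p.1 p.2 - W p| * ((u p.1 p.2 + W p) / 2)))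
      have h2 := h1.add (((hχt p.2).const_mul (θ p.1)).mul_const (res p))
      convert h2 using 2
      ring
  have h0 := ge_of_tendsto' hlim hf0
  have i1 := iD _ hθd hθdz
  have h1 : 0 ≤ ∫ p, (deriv θ p.1 * |u p.1 p.2 - W p| + θ p.1 * R p) ∂μ := by
    refine h0.trans (integral_mono_ae (i1.add ?_) (i1.add iR) (Eventually.of_forall fun p => ?_))
    · refine iR.mono' ((hθcont.comp continuous_fst).aestronglyMeasurable.mul hresm)
        (Eventually.of_forall fun p => ?_)
      by_cases ht : p.1 ∈ tsupport θ
      · rw [Real.norm_eq_abs, abs_of_nonneg (mul_nonneg (hθ0 _) (abs_nonneg _))]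
        exact mul_le_mul_of_nonneg_left (hresR p (hsub _ ht)) (hθ0 _)
      · simp [hθz _ ht]
    · by_cases ht : p.1 ∈ tsupport θ
      · have := mul_le_mul_of_nonneg_left (hresR p (hsub _ ht)) (hθ0 p.1)
        dsimp only
        linarith
      · simp [hθz _ ht]
  rw [hμ, restrict_Ioi_prod_univ] at h1 i1 iR
  have hi : Integrable (fun p : ℝ × ℝ => deriv θ p.1 * |u p.1 p.2 - W p| + θ p.1 * R p)
      ((volume.restrict (Ioi 0)).prod volume) := i1.add iR
  rw [integral_prod _ hi] at h1
  have hθtz : ∀ t, t ∉ Ioi (0 : ℝ) → t ∉ tsupport θ := fun t ht h =>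
    ht (ha.trans_lt (hθs h).1)
  rw [← setIntegral_eq_integral_of_forall_compl_eq_zero (s := Ioi (0 : ℝ)) fun t ht => by
    rw [hθz t (hθtz t ht), hθdz t (hθtz t ht)]; simp]
  refine h1.trans (integral_mono_ae hi.integral_prod_left ?_
    (Eventually.of_forall fun t => ?_))
  · have e : ∀ t, deriv θ t * ∫ x, |u t x - advect w (t - a) x|
        = ∫ x, deriv θ t * |u t x - advect w (t - a) x| := fun t => by rw [integral_const_mul]
    simp only [e]
    exact i1.integral_prod_left.add ((hθcont.integrable_of_hasCompactSupport hθc).mul_const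
      _).integrableOn
  · by_cases ht : t ∈ tsupport θ
    · have := mul_le_mul_of_nonneg_left (hRint t (hsub _ ht)) (hθ0 t)
      simp only
      rw [integral_add ((hDi t (hsub t ht)).const_mul _) ((hRi t (hsub t ht)).const_mul _),
        integral_const_mul, integral_const_mul]
      linarith
    · simp [hθz _ ht, hθdz _ ht]

end IsWeakEntropySolution

/-! ### Local error of a step -/

theorem IsC1Profile.mono {w : ℝ → ℝ} {L L' : ℝ} (h : IsC1Profile w L) (hL : L ≤ L') :
    IsC1Profile w L' :=
  ⟨h.contDiff, h.integrable, fun x => (h.abs_deriv_le x).trans hL⟩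

/-- The constant in the local error of a step. -/
noncomputable def stepConst (L : ℝ) : ℝ := (L + 1) + (L * (L + 1) + (L + 2) * (L + L ^ 2))

theorem stepConst_nonneg {L : ℝ} (hL : 0 ≤ L) : 0 ≤ stepConst L := by
  unfold stepConst
  positivity

/-- The error grows at a rate at most `∫ |u - w|`, that is, the error itself plus the drift `δ *
stepSpeed`, plus the residual of order `δ`. Bounding the rate through the maximum of the error on
the step replaces Gronwall's lemma and leaves the factor `1 - δ`. -/
theorem IsWeakEntropySolution.step_error_le {ubar : ℝ → ℝ} {u : ℝ → ℝ → ℝ} {w : ℝ → ℝ}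
    {L a δ : ℝ} (hu : IsWeakEntropySolution ubar u) (hw : IsC1Profile w L) (ha : 0 ≤ a)
    (hδ : 0 ≤ δ) (hδ1 : δ ≤ 1) :
    (1 - δ) * ∫ x, |u (a + δ) x - advect w δ x|
      ≤ (∫ x, |u a x - w x|) + δ ^ 2 * (stepConst L * ∫ x, |w x|) := by
  set A : ℝ → ℝ := fun t => ∫ x, |u t x - advect w (t - a) x|
  have hA : ContinuousOn A (Icc a (a + δ)) := hu.continuousOn_integral_abs_sub_advect hw ha
  have hA0 : ∀ t, 0 ≤ A t := fun t => integral_nonneg fun x => abs_nonneg _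
  have hAa : A a = ∫ x, |u a x - w x| := by simp [A]
  have hAb : A (a + δ) = ∫ x, |u (a + δ) x - advect w δ x| := by simp [A]
  rw [← hAa, ← hAb]
  obtain ⟨s, hs, hmax⟩ := isCompact_Icc.exists_isMaxOn (nonempty_Icc.2 (by linarith)) hA
  have hS1 := integral_nonneg (μ := volume) (Pi.le_def.2 hw.stepSpeed_nonneg)
  have hS2 := hw.integral_stepSpeed_le
  have hD1 : 0 ≤ ∫ x, stepDefect w L x := integral_nonneg fun x => by
    have := hw.nonneg
    have := hw.stepSpeed_nonneg x
    unfold stepDefect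
    simp only [Pi.zero_apply]
    positivity
  have hD2 := hw.integral_stepDefect_le
  have hQ : δ ^ 2 * ((∫ x, stepSpeed w L x) + ∫ x, stepDefect w L x)
      ≤ δ ^ 2 * (stepConst L * ∫ x, |w x|) := by
    refine mul_le_mul_of_nonneg_left ?_ (sq_nonneg _)
    unfold stepConst
    linarith
  have hAsb : A (a + δ) ≤ A s := hmax ⟨by linarith, le_rfl⟩
  have key : A s ≤ A a + δ * (A s + δ * (∫ x, stepSpeed w L x) + δ * ∫ x, stepDefect w L x) := by
    rcases hs.1.eq_or_lt with has | has
    · have h1 : 0 ≤ δ * (A s + δ * (∫ x, stepSpeed w L x) + δ * ∫ x, stepDefect w L x) := by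
        have := hA0 s
        positivity
      rw [← has] at h1 ⊢
      linarith
    have hβ : ∀ t ∈ Icc a s, ∫ x, |u t x - w x| ≤ A s + δ * ∫ x, stepSpeed w L x := by
      intro t ht
      have hta : 0 ≤ t - a := sub_nonneg.2 ht.1
      have i1 : Integrable fun x => |u t x - advect w (t - a) x| :=
        ((hu.integrable t (ha.trans ht.1)).sub (hw.advect_isC1Profile hta).integrable).abs
      have i2 := hw.integrable_stepSpeed.const_mul δ
      have h1 : A t ≤ A s := hmax ⟨ht.1, ht.2.trans hs.2⟩
      calc ∫ x, |u t x - w x|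
          ≤ ∫ x, (|u t x - advect w (t - a) x| + δ * stepSpeed w L x) := by
            refine integral_mono ((hu.integrable t (ha.trans ht.1)).sub hw.integrable).abs
              (i1.add i2) fun x => ?_
            have h2 := hw.abs_advect_sub_le 0 (t - a) x
            rw [advect_zero, sub_zero, abs_of_nonneg hta] at h2
            have h3 : (t - a) * stepSpeed w L x ≤ δ * stepSpeed w L x :=
              mul_le_mul_of_nonneg_right (by linarith [ht.2, hs.2]) (hw.stepSpeed_nonneg x)
            have h4 := abs_sub_le (u t x) (advect w (t - a) x) (w x)
            dsimp only
            linarith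
        _ = A t + δ * ∫ x, stepSpeed w L x := by
            rw [integral_add i1 i2, integral_const_mul]
        _ ≤ _ := by linarith
    have hAs : ContinuousOn A (Icc a s) := hA.mono (Icc_subset_Icc_right hs.2)
    -- The weak inequality is stated for functions continuous on the whole line; test functions
    -- supported in `(a, s)` do not see the constant extension.
    have hE : Continuous (IccExtend has.le ((Icc a s).domRestrict A)) :=
      hAs.domRestrict.Icc_extend'
    have hEeq : ∀ t ∈ Icc a s, IccExtend has.le ((Icc a s).domRestrict A) t = A t := fun t ht => by
      rw [IccExtend_of_mem _ _ ht]
      rfl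
    have hβ0 : 0 ≤ A s + δ * (∫ x, stepSpeed w L x) + (s - a) * ∫ x, stepDefect w L x := by
      have := hA0 s
      have := sub_nonneg.2 hs.1
      positivity
    have h1 := le_add_of_forall_test (β := A s + δ * (∫ x, stepSpeed w L x)
      + (s - a) * ∫ x, stepDefect w L x) hE has hβ0 fun θ h1 h2 h3 h4 => by
        refine (hu.advect_test hw ha (b := s) (by linarith [hs.2]) hβ h1 h2 h3 h4).trans
          (le_of_eq (integral_congr_ae (Eventually.of_forall fun t => ?_)))
        by_cases ht : t ∈ tsupport θ
        · simp only
          rw [hEeq t (Ioo_subset_Icc_self (h4 ht))]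
        · have h5 : deriv θ t = 0 :=
            image_eq_zero_of_notMem_tsupport fun h => ht (tsupport_deriv_subset h)
          simp [h5]
    rw [hEeq a ⟨le_rfl, has.le⟩, hEeq s ⟨has.le, le_rfl⟩] at h1
    have h2 : s - a ≤ δ := by linarith [hs.2]
    refine h1.trans ?_
    gcongr
  have h3 : (1 - δ) * A (a + δ) ≤ (1 - δ) * A s :=
    mul_le_mul_of_nonneg_left hAsb (by linarith)
  linarith

/-! ### The slope bound and iteration of the scheme -/

/-- The solution of `y' = y + y²`, `y(0) = m`. -/
noncomputable def lipBound (m s : ℝ) : ℝ := m * Real.exp s / (1 + m - m * Real.exp s)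

theorem lipBound_step {m s δ : ℝ} (hm : 0 ≤ m) (hδ : 0 ≤ δ)
    (h : m * Real.exp (s + δ) < 1 + m) :
    lipBound m s * (1 + δ * lipBound m s) + δ * lipBound m s ≤ lipBound m (s + δ) := by
  have hq := Real.add_one_le_exp δ
  have hE := Real.exp_pos s
  unfold lipBound
  rw [Real.exp_add] at *
  generalize Real.exp δ = q at *
  generalize Real.exp s = E at *
  have hD' : 0 < 1 + m - m * (E * q) := by linarith
  have hmE : 0 ≤ m * E := by positivity
  have hDD : 1 + m - m * (E * q) ≤ 1 + m - m * E := by nlinarith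
  have hD : 0 < 1 + m - m * E := hD'.trans_le hDD
  set D := 1 + m - m * E
  set D' := 1 + m - m * (E * q)
  -- The Euler increment and the exact increment differ only in `δ` against `q - 1 = e^δ - 1` and in
  -- `D` against the smaller `D'`; both comparisons favour the exact solution.
  have e1 : m * E / D * (1 + δ * (m * E / D)) + δ * (m * E / D)
      = m * E / D + m * E * (1 + m) * δ / (D * D) := by
    field_simp
    simp only [D]
    ring
  have e2 : m * (E * q) / D' = m * E / D + m * E * (1 + m) * (q - 1) / (D * D') := by
    field_simp
    simp only [D, D']
    ring
  rw [e1, e2]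
  gcongr
  · exact mul_nonneg (by positivity) (by linarith)
  · linarith

theorem lipBound_mono {m s t : ℝ} (hm : 0 ≤ m) (hst : s ≤ t) (h : m * Real.exp t < 1 + m) :
    lipBound m s ≤ lipBound m t := by
  have h1 := Real.exp_le_exp.2 hst
  have h2 := mul_le_mul_of_nonneg_left h1 hm
  unfold lipBound
  gcongr

theorem lipBound_nonneg {m s : ℝ} (hm : 0 ≤ m) (h : m * Real.exp s < 1 + m) :
    0 ≤ lipBound m s :=
  div_nonneg (by positivity) (by linarith)

/-- The approximate solution at time `n δ`. -/
noncomputable def approxSol (ubar : ℝ → ℝ) (δ : ℝ) : ℕ → ℝ → ℝ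
  | 0 => ubar
  | n + 1 => advect (approxSol ubar δ n) δ

theorem approxSol_isC1Profile {ubar : ℝ → ℝ} {m δ T : ℝ} (h : IsC1Profile ubar m) (hδ : 0 ≤ δ)
    (hT : m * Real.exp T < 1 + m) (n : ℕ) (hn : n * δ ≤ T) :
    IsC1Profile (approxSol ubar δ n) (lipBound m (n * δ)) := by
  have hm := h.nonneg
  induction n with
  | zero => simpa [approxSol, lipBound] using h
  | succ n ih =>
    have hn' : (n : ℝ) * δ + δ ≤ T := by push_cast at hn; linarith
    have h1 := (ih (by linarith)).advect_isC1Profile hδ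
    have h2 : m * Real.exp (n * δ + δ) < 1 + m :=
      lt_of_le_of_lt (mul_le_mul_of_nonneg_left (Real.exp_le_exp.2 hn') hm) hT
    have h3 := h1.mono (lipBound_step hm hδ h2)
    have e : ((n + 1 : ℕ) : ℝ) * δ = n * δ + δ := by push_cast; ring
    rw [e]
    exact h3

theorem IsWeakEntropySolution.approxSol_error_le {ubar : ℝ → ℝ} {u : ℝ → ℝ → ℝ} {m δ T : ℝ}
    (hu : IsWeakEntropySolution ubar u) (h : IsC1Profile ubar m) (hδ : 0 ≤ δ) (hδ1 : δ ≤ 1)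
    (hT : m * Real.exp T < 1 + m) (n : ℕ) (hn : n * δ ≤ T) :
    (∫ x, |approxSol ubar δ n x|)
        ≤ Real.exp ((lipBound m T + 1) * (n * δ)) * (∫ x, |ubar x|) ∧
      (1 - δ) ^ n * ∫ x, |u (n * δ) x - approxSol ubar δ n x| ≤ n * δ * (δ *
        (stepConst (lipBound m T) * (Real.exp ((lipBound m T + 1) * T) * ∫ x, |ubar x|))) := by
  have hm := h.nonneg
  have hC0 := lipBound_nonneg hm hT
  set C := lipBound m T
  have hI : 0 ≤ ∫ x, |ubar x| := integral_nonneg fun x => abs_nonneg _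
  induction n with
  | zero =>
    refine ⟨by simp [approxSol], ?_⟩
    have h0 : ∫ x, |u 0 x - ubar x| = 0 := by
      refine integral_eq_zero_of_ae ?_
      filter_upwards [hu.initial] with x hx
      simp [hx]
    simp [approxSol, h0]
  | succ n ih =>
    have e : ((n + 1 : ℕ) : ℝ) * δ = n * δ + δ := by push_cast; ring
    rw [e] at hn ⊢
    have hnδ : (n : ℝ) * δ ≤ T := by linarith
    obtain ⟨ih1, ih2⟩ := ih hnδ
    have hw : IsC1Profile (approxSol ubar δ n) C :=
      (approxSol_isC1Profile h hδ hT n hnδ).mono (lipBound_mono hm hnδ hT)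
    constructor
    · refine (hw.integral_abs_advect_le hδ).trans ?_
      have h1 := Real.add_one_le_exp (δ * (C + 1))
      have e2 : Real.exp ((C + 1) * (n * δ + δ)) * ∫ x, |ubar x|
          = Real.exp (δ * (C + 1)) * (Real.exp ((C + 1) * (n * δ)) * ∫ x, |ubar x|) := by
        rw [← mul_assoc, ← Real.exp_add]
        congr 2
        ring
      rw [e2, add_comm 1]
      gcongr
    · have h1 := hu.step_error_le hw (a := n * δ) (by positivity) hδ hδ1
      have h2 : ∫ x, |approxSol ubar δ n x| ≤ Real.exp ((C + 1) * T) * ∫ x, |ubar x| := by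
        refine ih1.trans ?_
        gcongr
      have h3 : δ ^ 2 * (stepConst C * ∫ x, |approxSol ubar δ n x|)
          ≤ δ ^ 2 * (stepConst C * (Real.exp ((C + 1) * T) * ∫ x, |ubar x|)) := by
        have := stepConst_nonneg hC0
        gcongr
      set Q := stepConst C * (Real.exp ((C + 1) * T) * ∫ x, |ubar x|)
      have hQ : 0 ≤ δ ^ 2 * Q := by
        have := stepConst_nonneg hC0
        positivity
      -- The weight `(1 - δ)^n` makes the one-step inequalities telescope: each step adds at most `δ
      -- ^ 2 * Q`.
      have h4 := mul_le_mul_of_nonneg_left h1 (pow_nonneg (sub_nonneg.2 hδ1) n)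
      have h5 : (1 - δ) ^ n ≤ 1 := pow_le_one₀ (by linarith) (by linarith)
      have h6 : (1 - δ) ^ n * (δ ^ 2 * (stepConst C * ∫ x, |approxSol ubar δ n x|))
          ≤ δ ^ 2 * Q :=
        (mul_le_mul_of_nonneg_left h3 (pow_nonneg (sub_nonneg.2 hδ1) n)).trans
          (mul_le_of_le_one_left hQ h5)
      calc (1 - δ) ^ (n + 1) * ∫ x, |u (n * δ + δ) x - approxSol ubar δ (n + 1) x|
          = (1 - δ) ^ n * ((1 - δ)
            * ∫ x, |u (n * δ + δ) x - advect (approxSol ubar δ n) δ x|) := by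
            rw [pow_succ, mul_assoc]
            rfl
        _ ≤ _ := by linarith

/-! ### Passage to the limit -/

theorem exists_lipschitzWith_ae_eq {f : ℝ → ℝ} {w : ℕ → ℝ → ℝ} {C : ℝ≥0} (hf : Integrable f)
    (hw : ∀ n, LipschitzWith C (w n)) (hwi : ∀ n, Integrable (w n))
    (hlim : Tendsto (fun n => ∫ x, |f x - w n x|) atTop (𝓝 0)) :
    ∃ g, LipschitzWith C g ∧ f =ᵐ[volume] g := by
  have h1 : Tendsto (fun n => eLpNorm (w n - f) 1 volume) atTop (𝓝 0) := by
    have h2 : ∀ n, eLpNorm (w n - f) 1 volume = ENNReal.ofReal (∫ x, |f x - w n x|) := fun n => by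
      rw [eLpNorm_one_eq_lintegral_enorm, ← ofReal_integral_norm_eq_lintegral_enorm
        ((hwi n).sub hf)]
      congr 1
      refine integral_congr_ae (Eventually.of_forall fun x => ?_)
      simp only [Pi.sub_apply, Real.norm_eq_abs]
      exact abs_sub_comm _ _
    simp only [h2]
    simpa using ENNReal.tendsto_ofReal hlim
  obtain ⟨ns, -, hns⟩ := (tendstoInMeasure_of_tendsto_eLpNorm one_ne_zero
    (fun n => (hwi n).aestronglyMeasurable) hf.aestronglyMeasurable h1).exists_seq_tendsto_ae
  -- Along a subsequence the convergence holds a.e.; the Lipschitz bound passes to the limit on that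
  -- set of full measure and then extends to the line.
  have h3 : LipschitzOnWith C f {x | Tendsto (fun i => w (ns i) x) atTop (𝓝 (f x))} :=
    LipschitzOnWith.of_dist_le_mul fun x hx y hy =>
      le_of_tendsto' (hx.dist hy) fun i => (hw (ns i)).dist_le_mul x y
  obtain ⟨g, hg, hfg⟩ := h3.extend_real
  exact ⟨g, hg, hns.mono fun x hx => hfg hx⟩

theorem hasWeakDeriv_of_ae_eq_lipschitzWith {f g : ℝ → ℝ} {C : ℝ≥0} (hf : LocallyIntegrable f)
    (hg : LipschitzWith C g) (hfg : f =ᵐ[volume] g) : HasWeakDeriv f (deriv g) where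
  locallyIntegrable := hf
  locallyIntegrable_deriv := by
    have h : MemLp (deriv g) ∞ volume :=
      memLp_top_of_bound (measurable_deriv g).aestronglyMeasurable C
        (Eventually.of_forall fun x => norm_deriv_le_of_lipschitz hg)
    exact h.locallyIntegrable le_top
  integral_eq φ hφ hφc := by
    obtain ⟨D, hD⟩ := ContDiff.lipschitzWith_of_hasCompactSupport hφc hφ (by simp)
    have h := hg.integral_lineDeriv_mul_eq (μ := volume) hD hφc 1
    have e (k : ℝ → ℝ) (x : ℝ) : lineDeriv ℝ k x 1 = deriv k x := by
      simp [lineDeriv, deriv_comp_const_add]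
    simp only [lineDeriv_neg, e, neg_mul, integral_neg] at h
    rw [h, neg_neg]
    refine integral_congr_ae ?_
    filter_upwards [hfg] with x hx
    rw [hx, mul_comm]

theorem eLpNorm_deriv_le_of_lipschitzWith {g : ℝ → ℝ} {C : ℝ≥0} (hg : LipschitzWith C g) :
    eLpNorm (deriv g) ∞ volume ≤ C := by
  rw [eLpNorm_exponent_top]
  exact eLpNormEssSup_le_of_ae_nnnorm_bound
    (Eventually.of_forall fun x => norm_deriv_le_of_lipschitz hg)

theorem IsWeakEntropySolution.exists_lipschitzWith_ae_eq {ubar : ℝ → ℝ} {u : ℝ → ℝ → ℝ}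
    {m T t : ℝ} (hu : IsWeakEntropySolution ubar u) (h : IsC1Profile ubar m)
    (hT : m * Real.exp T < 1 + m) (ht : t ∈ Icc 0 T) :
    ∃ g, LipschitzWith (lipBound m T).toNNReal g ∧ u t =ᵐ[volume] g := by
  have hC0 := lipBound_nonneg h.nonneg hT
  -- Splitting `[0, t]` into `n + N + 1` equal steps keeps the step length at most `1` for every
  -- `n`.
  obtain ⟨N, hN⟩ := exists_nat_ge t
  have hpos : ∀ n : ℕ, (0 : ℝ) < ((n + N + 1 : ℕ) : ℝ) := fun n => by positivity
  have hmul : ∀ n : ℕ, ((n + N + 1 : ℕ) : ℝ) * (t / (n + N + 1 : ℕ)) = t := fun n =>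
    mul_div_cancel₀ t (hpos n).ne'
  have hδ0 : ∀ n : ℕ, 0 ≤ t / (n + N + 1 : ℕ) := fun n => div_nonneg ht.1 (hpos n).le
  have hδ1 : ∀ n : ℕ, t / (n + N + 1 : ℕ) ≤ 1 := fun n => by
    rw [div_le_one (hpos n)]
    push_cast
    linarith [(n.cast_nonneg : (0 : ℝ) ≤ n)]
  set w : ℕ → ℝ → ℝ := fun n => approxSol ubar (t / (n + N + 1 : ℕ)) (n + N + 1)
  have hw : ∀ n, IsC1Profile (w n) (lipBound m T) := fun n => by
    have h1 := approxSol_isC1Profile h (hδ0 n) hT (n + N + 1) (by rw [hmul]; exact ht.2)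
    rw [hmul] at h1
    exact h1.mono (lipBound_mono h.nonneg ht.2 hT)
  refine BurgersPoisson.exists_lipschitzWith_ae_eq (w := w) (hu.integrable t ht.1) (fun n => ?_)
    (fun n => (hw n).integrable) ?_
  · refine LipschitzWith.of_dist_le_mul fun x y => ?_
    rw [Real.coe_toNNReal _ hC0]
    exact (hw n).abs_sub_le x y
  set Q := stepConst (lipBound m T) * (Real.exp ((lipBound m T + 1) * T) * ∫ x, |ubar x|)
  have hle : ∀ n : ℕ, (1 - t / (n + N + 1 : ℕ)) ^ (n + N + 1) * ∫ x, |u t x - w n x|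
      ≤ t * (t / (n + N + 1 : ℕ) * Q) := fun n => by
    have h1 := (hu.approxSol_error_le h (hδ0 n) (hδ1 n) hT (n + N + 1)
      (by rw [hmul]; exact ht.2)).2
    rwa [hmul] at h1
  have hshift : Tendsto (fun n : ℕ => n + N + 1) atTop atTop :=
    tendsto_atTop_mono (fun n => show n ≤ n + N + 1 by omega) tendsto_id
  have l1 : Tendsto (fun n : ℕ => (1 - t / (n + N + 1 : ℕ)) ^ (n + N + 1)) atTop
      (𝓝 (Real.exp (-t))) := by
    have := (Real.tendsto_one_add_div_pow_exp (-t)).comp hshift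
    refine this.congr fun n => ?_
    simp only [Function.comp_apply]
    rw [neg_div, ← sub_eq_add_neg]
  have l2 : Tendsto (fun n : ℕ => t * (t / (n + N + 1 : ℕ) * Q)) atTop (𝓝 0) := by
    have := (((tendsto_const_div_atTop_nhds_zero_nat t).comp hshift).mul_const Q).const_mul t
    simpa only [zero_mul, mul_zero, Function.comp_apply] using this
  -- The accumulated weight tends to `e^{-t} > 0`, so dividing by it preserves convergence of the
  -- error to zero.
  have l3 := l2.div l1 (Real.exp_pos _).ne'
  rw [zero_div] at l3
  refine squeeze_zero' (Eventually.of_forall fun n => integral_nonneg fun x => abs_nonneg _) ?_ l3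
  filter_upwards [l1.eventually (lt_mem_nhds (Real.exp_pos (-t)))] with n hn
  rw [Pi.div_apply, le_div_iff₀ hn, mul_comm]
  exact hle n

/-! ### The blow-up time and the conclusion -/

theorem abs_deriv_le_toReal_eLpNorm {f : ℝ → ℝ} (hf : ContDiff ℝ 1 f)
    (hm : eLpNorm (deriv f) ∞ volume ≠ ⊤) (x : ℝ) :
    |deriv f x| ≤ (eLpNorm (deriv f) ∞ volume).toReal := by
  have hc : Continuous (deriv f) := hf.continuous_deriv le_rfl
  have hae : ∀ᵐ x, |deriv f x| ≤ (eLpNorm (deriv f) ∞ volume).toReal := by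
    rw [eLpNorm_exponent_top] at hm ⊢
    filter_upwards [enorm_ae_le_eLpNormEssSup (deriv f) volume] with x hx
    have := ENNReal.toReal_mono hm hx
    simpa using this
  have hd := Measure.dense_of_ae hae
  have hcl : IsClosed {x | |deriv f x| ≤ (eLpNorm (deriv f) ∞ volume).toReal} :=
    isClosed_le hc.abs continuous_const
  have : x ∈ closure {x | |deriv f x| ≤ (eLpNorm (deriv f) ∞ volume).toReal} := hd x
  rwa [hcl.closure_eq] at this

/-- The time restriction with denominators cleared, so that it also covers `m = 0`, where `1 / m` is
infinite. -/
theorem toReal_mul_exp_lt {m : ℝ≥0∞} (hm : m ≠ ⊤) {T : ℝ}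
    (hT : (T : EReal) < ENNReal.log (1 + 1 / m)) :
    m.toReal * Real.exp T < 1 + m.toReal := by
  rcases eq_or_ne m 0 with rfl | h0
  · simp
  have hpos := ENNReal.toReal_pos h0 hm
  rw [← EReal.log_exp (T : EReal), ENNReal.log_lt_log_iff, EReal.exp_coe,
    ENNReal.ofReal_lt_iff_lt_toReal (Real.exp_pos _).le (by simp [h0])] at hT
  rw [ENNReal.toReal_add (by simp) (by simp [h0]), ENNReal.toReal_div] at hT
  simp only [ENNReal.toReal_one] at hT
  have := mul_lt_mul_of_pos_left hT hpos
  rw [mul_add, mul_one, mul_one_div_cancel hpos.ne'] at this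
  linarith

end BurgersPoisson

theorem mainTheorem4 (ubar : ℝ → ℝ) (u : ℝ → ℝ → ℝ) (m : ℝ≥0∞)
    (hC1 : ContDiff ℝ 1 ubar) (hL1 : Integrable ubar)
    (hm : m = eLpNorm (deriv ubar) ∞ volume)
    (hu : BurgersPoisson.IsWeakEntropySolution ubar u) :
    ∀ T : ℝ, (T : EReal) < ENNReal.log (1 + 1 / m) →
      ∃ C : ℝ≥0, ∀ t ∈ Icc 0 T, ∃ ux : ℝ → ℝ,
        BurgersPoisson.HasWeakDeriv (u t) ux ∧ eLpNorm ux ∞ volume ≤ C := by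
  intro T hT
  -- For `m = ⊤` the time bound is `log 1 = 0`, so `T < 0` and there is no `t` to treat.
  rcases eq_or_ne m ⊤ with htop | htop
  · have hT0 : T < 0 := by
      rw [htop] at hT
      simpa using hT
    exact ⟨0, fun t ht => absurd (ht.1.trans ht.2) (not_le.2 hT0)⟩
  have hprof : BurgersPoisson.IsC1Profile ubar m.toReal :=
    ⟨hC1, hL1, fun x => by
      subst hm
      exact BurgersPoisson.abs_deriv_le_toReal_eLpNorm hC1 htop x⟩
  have hexp := BurgersPoisson.toReal_mul_exp_lt htop hT
  refine ⟨(BurgersPoisson.lipBound m.toReal T).toNNReal, fun t ht => ?_⟩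
  obtain ⟨g, hg, hug⟩ := hu.exists_lipschitzWith_ae_eq hprof hexp ht
  exact ⟨deriv g, BurgersPoisson.hasWeakDeriv_of_ae_eq_lipschitzWith
    (hu.integrable t ht.1).locallyIntegrable hg hug,
    BurgersPoisson.eLpNorm_deriv_le_of_lipschitzWith hg⟩
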